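/- **Theorem 2.** For $L\ge 1$ consider the square lattice with vertex set $(\mathbb Z/L)^2$ and periodic boundary conditions, with one qubit on each link; the horizontal link to the right of a vertex $v$ and the vertical link above $v$ belong to the site $v$. Let $$V=V_L=\{\psi:\ A_\square\psi=\psi,\ B_+\psi=\psi\ \text{for all plaquettes } \square \text{ and all vertices } +\},\qquad A_\square=\prod_{i\in\square}X_i,\quad B_+=\prod_{i\in +}Z_i,$$ be the ($4$-dimensional) code space of the toric code on this torus. A *local channel (LC) transformation of range at most $r$* is a quantum channel $\mathcal C$ from the link qubits to the link qubits of the following form: (1) add finitely many qubits to each site, all in the state $|0\rangle$; (2) apply a unitary circuit, that is, finitely many layers of unitary gates, the gates of each layer acting on disjoint sets of qubits, such that (maximal range of a gate)$\,\times\,$(number of layers) $\le r$, where the range of a gate is the largest lattice distance between the sites of two of its qubits; (3) at each site keep two qubits, which are the new link qubits of that site, and trace out all the others. Let $r(L)$ be natural numbers with $r(L)/L\to 0$ as $L\to\infty$. Then there is an $L_0$, depending only on the function $r$, such that for all $L\ge L_0$ and every LC transformation $\mathcal C$ of range at most $r(L)$ on the $L\times L$ torus: if $$\mathsf{supp}\;\mathcal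 C(|\psi\rangle\langle\psi|)\subseteq V\qquad\text{for all } |\psi\rangle\in V,$$ where $\mathsf{supp}\,K$ is the span of the eigenvectors of $K\ge 0$ with positive eigenvalues, then $\mathcal C$ acts on $V$ as a unitary channel: there is a unitary $W$ of $V$ with $\mathcal C(X)=WXW^\dagger$ for every operator $X$ on $V$ (extended by zero to the orthogonal complement of $V$). -/

import Mathlib

open Matrix Filter Topology

namespace ToricLC

/-! ### Systems of qubits -/

/-- Computational basis configurations of a system of qubits labelled by `Q`. -/
abbrev Config (Q : Type) : Type := Q → Fin 2

/-- (Unnormalised) state vectors of the qubits labelled by `Q`. -/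
abbrev StateVec (Q : Type) : Type := Config Q → ℂ

/-- Operators on the Hilbert space of the qubits labelled by `Q`. -/
abbrev Op (Q : Type) : Type := Matrix (Config Q) (Config Q) ℂ

/-- The Pauli operator `X` on the qubit `q`: it flips `q`. -/
def pauliX {Q : Type} [DecidableEq Q] [Fintype Q] (q : Q) : Op Q :=
  Matrix.of fun s t => if s = Function.update t q (t q + 1) then 1 else 0

/-- The Pauli operator `Z` on the qubit `q`. -/
def pauliZ {Q : Type} [DecidableEq Q] [Fintype Q] (q : Q) : Op Q :=
  Matrix.diagonal fun s => if s q = 0 then 1 else -1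

/-- The operator `N ⊗ 1`, where `N` acts on the qubits in `S`, and `1` on all the others. -/
def embedOp {Q : Type} [DecidableEq Q] [Fintype Q] (S : Finset Q)
    (N : Matrix (S → Fin 2) (S → Fin 2) ℂ) : Op Q :=
  Matrix.of fun s t =>
    if ∀ q, q ∉ S → s q = t q then N (fun q => s q.1) (fun q => t q.1) else 0

/-- The projector `|ψ⟩⟨ψ|` (for a unit vector `ψ`). -/
def ketbra {Q : Type} (ψ : StateVec Q) : Op Q := Matrix.vecMulVec ψ (star ψ)

/-- The support of a positive semidefinite operator: the span of its eigenvectors with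
positive eigenvalues. -/
def supp {Q : Type} [DecidableEq Q] [Fintype Q] (K : Op Q) : Submodule ℂ (StateVec Q) :=
  Submodule.span ℂ {v | ∃ μ : ℝ, 0 < μ ∧ K *ᵥ v = (μ : ℂ) • v}

/-- `X` is an operator on the subspace `V`, extended by zero on the orthogonal complement
of `V`: the ranges of `X` and of its adjoint lie in `V`. -/
def IsOperatorOn {Q : Type} [DecidableEq Q] [Fintype Q] (V : Submodule ℂ (StateVec Q))
    (X : Op Q) : Prop :=
  (∀ v, X *ᵥ v ∈ V) ∧ (∀ v, Xᴴ *ᵥ v ∈ V)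

/-- The map `Φ`, restricted to the operators on `V`, is a unitary channel `X ↦ W X Wᴴ` of `V`.
(Every unitary of `V` is the restriction of a unitary of the whole space that preserves `V`.) -/
def ActsAsUnitaryChannelOn {Q : Type} [DecidableEq Q] [Fintype Q]
    (V : Submodule ℂ (StateVec Q)) (Φ : Op Q → Op Q) : Prop :=
  ∃ W ∈ Matrix.unitaryGroup (Config Q) ℂ, (∀ ψ ∈ V, W *ᵥ ψ ∈ V) ∧
    ∀ X, IsOperatorOn V X → Φ X = W * X * Wᴴ

/-! ### The toric code -/

/-- The sites (vertices) of the `L × L` square lattice with periodic boundary conditions. -/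
abbrev Site (L : ℕ) : Type := ZMod L × ZMod L

/-- The links of the periodic square lattice: `(v, 0)` is the horizontal link from `v` to
`v + (1, 0)`, and `(v, 1)` is the vertical link from `v` to `v + (0, 1)`. The links `(v, 0)` and
`(v, 1)` form the unit cell of the site `v`. -/
abbrev Link (L : ℕ) : Type := Site L × Fin 2

/-- The `ℓ¹` distance on the torus. -/
def torusDist {L : ℕ} (v w : Site L) : ℕ :=
  (v.1 - w.1).valMinAbs.natAbs + (v.2 - w.2).valMinAbs.natAbs

/-- The product of `X` over the four links of the plaquette with lower left corner `v`. -/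
def plaquetteOp {L : ℕ} [NeZero L] (v : Site L) : Op (Link L) :=
  pauliX (v, 0) * pauliX (v + (0, 1), 0) * pauliX (v, 1) * pauliX (v + (1, 0), 1)

/-- The product of `Z` over the four links that meet at the vertex `v`. -/
def starOp {L : ℕ} [NeZero L] (v : Site L) : Op (Link L) :=
  pauliZ (v, 0) * pauliZ (v - (1, 0), 0) * pauliZ (v, 1) * pauliZ (v - (0, 1), 1)

/-- The code space of the toric code: the anyon-free states. -/
def codeSpace (L : ℕ) [NeZero L] : Submodule ℂ (StateVec (Link L)) where
  carrier := {ψ | ∀ v, plaquetteOp v *ᵥ ψ = ψ ∧ starOp v *ᵥ ψ = ψ}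
  zero_mem' := by intro v; simp
  add_mem' := by
    intro a b ha hb v
    simp [Matrix.mulVec_add, (ha v).1, (ha v).2, (hb v).1, (hb v).2]
  smul_mem' := by
    intro c a ha v
    simp [Matrix.mulVec_smul, (ha v).1, (ha v).2]

/-! ### Local channel transformations -/

/-- All qubits after `anc v` fresh qubits have been added to each site `v`: the links, and the
added qubits. -/
abbrev Qubit (L : ℕ) (anc : Site L → ℕ) : Type := Link L ⊕ (Σ v : Site L, Fin (anc v))

/-- The site of a qubit. -/
def siteOf {L : ℕ} {anc : Site L → ℕ} : Qubit L anc → Site L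
  | Sum.inl l => l.1
  | Sum.inr a => a.1

/-- A unitary gate on a finite set of qubits. -/
structure Gate (Q : Type) [DecidableEq Q] where
  /-- the qubits that the gate acts on -/
  qubits : Finset Q
  /-- the unitary that is applied to these qubits -/
  mat : Matrix (qubits → Fin 2) (qubits → Fin 2) ℂ
  unitary : mat ∈ Matrix.unitaryGroup (qubits → Fin 2) ℂ

/-- The unitary of a layer of gates (which commute when they act on disjoint sets of qubits). -/
def layerOp {Q : Type} [DecidableEq Q] [Fintype Q] (gates : List (Gate Q)) : Op Q :=
  (gates.map fun g => embedOp g.qubits g.mat).prod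

/-- The unitary of a circuit, given by the list of its layers; the head is applied first. -/
def circuitOp {Q : Type} [DecidableEq Q] [Fintype Q] : List (List (Gate Q)) → Op Q
  | [] => 1
  | gates :: rest => circuitOp rest * layerOp gates

/-- The state `ρ ⊗ |0⟩⟨0|`, where all the added qubits are in the state `|0⟩`. -/
def addAncillas {P A : Type} [Fintype A] (ρ : Op P) : Op (P ⊕ A) :=
  Matrix.of fun s t =>
    if (∀ a, s (Sum.inr a) = 0) ∧ (∀ a, t (Sum.inr a) = 0) then
      ρ (fun p => s (Sum.inl p)) (fun p => t (Sum.inl p))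
    else 0

open Classical in
/-- The partial trace over all the qubits that are not in the range of `keep`; the qubit
`keep p` that is kept is labelled by `p`. -/
noncomputable def traceOut {P Q : Type} [Fintype Q] (keep : P ↪ Q) (M : Op Q) : Op P :=
  Matrix.of fun x y =>
    ∑ s : Config Q, ∑ t : Config Q,
      if (∀ p, s (keep p) = x p) ∧ (∀ p, t (keep p) = y p) ∧
          (∀ q, q ∉ Set.range keep → s q = t q) then M s t
      else 0

/-- A local channel transformation of range at most `r`, from the qubits on the links of the
periodic `L × L` lattice to the same system. -/
structure LCTransformation (L : ℕ) [NeZero L] (r : ℕ) where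
  /-- the number of qubits that are added to each site -/
  anc : Site L → ℕ
  /-- the layers of the unitary circuit -/
  layers : List (List (Gate (Qubit L anc)))
  /-- the gates of a layer act on disjoint sets of qubits -/
  disjoint : ∀ gates ∈ layers, gates.Pairwise fun g h => Disjoint g.qubits h.qubits
  /-- a bound for the ranges of the gates -/
  gateRange : ℕ
  gate_le : ∀ gates ∈ layers, ∀ g ∈ gates, ∀ q ∈ g.qubits, ∀ q' ∈ g.qubits,
    torusDist (siteOf q) (siteOf q') ≤ gateRange
  /-- the range of the circuit is the maximal range of its gates times its depth -/
  range_le : gateRange * layers.length ≤ r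
  /-- the two qubits of each site that are kept, as the new qubits of that site; all the others
  are traced out -/
  keep : Link L ↪ Qubit L anc
  keep_site : ∀ l, siteOf (keep l) = l.1

/-- The action of a local channel transformation on operators: add qubits in the state `|0⟩`,
apply the circuit, and trace out. -/
noncomputable def LCTransformation.channel {L : ℕ} [NeZero L] {r : ℕ}
    (C : LCTransformation L r) (ρ : Op (Link L)) : Op (Link L) :=
  traceOut C.keep
    (circuitOp C.layers * addAncillas (A := Σ v : Site L, Fin (C.anc v)) ρ *
      (circuitOp C.layers)ᴴ)

end ToricLC

set_option linter.unusedSectionVars false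

namespace ToricLC


/-! ### Products of Pauli operators, indexed by vectors over `ℤ/2` -/

section Pauli

variable {Q : Type}

/-! Write the channel with Kraus operators `T e = ⟨e| U J`, where `J` adds the qubits, `U` is the
circuit and `e` runs over the basis states of the discarded qubits. For `ψ ∈ V` the output is the
sum of the rank one operators of the vectors `T e ψ`, so the hypothesis forces every `T e` to map
`V` into itself (`fixed_of_supp_sum`).

The heart is `LCTransformation.exists_intertwined`: for a logical Pauli operator `O` and `ψ ∈ V`
there is one `φ ∈ V` with `O T e ψ = T e φ` for all `e` at once. On `V`, the loop operator `O`
equals a distant parallel loop operator `O'`. Let `K`, `K'` be their copies on the kept qubits. All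
slices of `U J ψ` lie in `V`, so `K` and `K'` agree on this vector. Put `χ = Uᴴ K U J ψ`. The vector
`J ψ` is fixed by local operators `B`: plaquettes, stars, and `Z` on each added qubit. By the light
cone, `U B Uᴴ` lives in a ball of radius `r + 1`, which cannot meet both loops. It therefore
commutes with `K` or with `K'`, and `B` fixes `χ` too. Hence `χ = J φ` with `φ ∈ V`.

The rest is algebra. With `P` the projection onto `V` and `D e = T e P`, intertwining shows that `D
e (D f)ᴴ` commutes with the logical operators. These act irreducibly on `V` (`logicals_irreducible`,
from the `ℤ/2` homology of the torus in `mem_of_closed`), so `D e (D f)ᴴ` is a multiple of `P`. All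
`D e` are then multiples of a single unitary (`sum_conj_eq_unitary`). -/

lemma config_add_self (c : Config Q) : c + c = 0 := by
  funext q
  simp only [Pi.add_apply, Pi.zero_apply]
  generalize c q = a
  revert a
  decide

lemma config_add_cancel (s c : Config Q) : s + c + c = s := by
  rw [add_assoc, config_add_self, add_zero]

/-- The nontrivial bicharacter of `ℤ/2`. -/
def bichar (a b : Fin 2) : ℂ := if a = 1 ∧ b = 1 then -1 else 1

lemma bichar_comm (a b : Fin 2) : bichar a b = bichar b a := by
  simp [bichar, and_comm]

lemma bichar_add_right (a b b' : Fin 2) : bichar a (b + b') = bichar a b * bichar a b' := by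
  fin_cases a <;> fin_cases b <;> fin_cases b' <;> simp [bichar]

lemma bichar_add_left (a a' b : Fin 2) : bichar (a + a') b = bichar a b * bichar a' b := by
  rw [bichar_comm, bichar_add_right, bichar_comm b, bichar_comm b]

@[simp] lemma bichar_zero_left (b : Fin 2) : bichar 0 b = 1 := by simp [bichar]

@[simp] lemma bichar_zero_right (b : Fin 2) : bichar b 0 = 1 := by simp [bichar]

lemma bichar_mul_self (a b : Fin 2) : bichar a b * bichar a b = 1 := by
  unfold bichar; split_ifs <;> norm_num

lemma star_bichar (a b : Fin 2) : star (bichar a b) = bichar a b := by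
  unfold bichar; split_ifs <;> simp

lemma bichar_one_eq_one {b : Fin 2} : bichar 1 b = 1 ↔ b = 0 := by
  fin_cases b <;> simp [bichar]
  norm_num

lemma bichar_sum {ι : Type} (F : Finset ι) (a : Fin 2) (f : ι → Fin 2) :
    bichar a (∑ i ∈ F, f i) = ∏ i ∈ F, bichar a (f i) := by
  classical
  induction F using Finset.induction_on with
  | empty => simp
  | insert i F hi ih => rw [Finset.sum_insert hi, Finset.prod_insert hi, bichar_add_right, ih]

variable [Fintype Q]

/-- The pairing of two configurations. -/
noncomputable def zChar (c s : Config Q) : ℂ := ∏ q, bichar (c q) (s q)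

lemma zChar_comm (c s : Config Q) : zChar c s = zChar s c :=
  Finset.prod_congr rfl fun _ _ => bichar_comm _ _

lemma zChar_add_right (c s t : Config Q) : zChar c (s + t) = zChar c s * zChar c t := by
  simp only [zChar, Pi.add_apply, bichar_add_right, Finset.prod_mul_distrib]

lemma zChar_add_left (c d s : Config Q) : zChar (c + d) s = zChar c s * zChar d s := by
  simp only [zChar, Pi.add_apply, bichar_add_left, Finset.prod_mul_distrib]

@[simp] lemma zChar_zero_left (s : Config Q) : zChar 0 s = 1 := by simp [zChar]

lemma zChar_mul_self (c s : Config Q) : zChar c s * zChar c s = 1 := by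
  simp only [zChar, ← Finset.prod_mul_distrib, bichar_mul_self, Finset.prod_const_one]

lemma star_zChar (c s : Config Q) : star (zChar c s) = zChar c s := by
  simp only [zChar, star_prod, star_bichar]

lemma zChar_sum_left {ι : Type} (F : Finset ι) (f : ι → Config Q) (s : Config Q) :
    zChar (∑ i ∈ F, f i) s = ∏ i ∈ F, zChar (f i) s := by
  classical
  induction F using Finset.induction_on with
  | empty => simp
  | insert i F hi ih => rw [Finset.sum_insert hi, Finset.prod_insert hi, zChar_add_left, ih]

variable [DecidableEq Q]

lemma zChar_single (q : Q) (s : Config Q) : zChar (Pi.single q 1) s = bichar 1 (s q) := by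
  rw [zChar, Finset.prod_eq_single q]
  · simp
  · intro b _ hb; simp [hb]
  · simp

/-- The product of the Pauli operators `X` over the qubits where `c` is `1`. -/
def xOp (c : Config Q) : Op Q := Matrix.of fun s t => if s = t + c then 1 else 0

/-- The product of the Pauli operators `Z` over the qubits where `c` is `1`. -/
noncomputable def zOp (c : Config Q) : Op Q := Matrix.diagonal (zChar c)

lemma xOp_mulVec (c : Config Q) (ψ : StateVec Q) (s : Config Q) :
    (xOp c *ᵥ ψ) s = ψ (s + c) := by
  have h : ∀ t : Config Q, s = t + c ↔ s + c = t := fun t =>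
    ⟨fun h => by rw [h, config_add_cancel], fun h => by rw [← h, config_add_cancel]⟩
  simp [xOp, Matrix.mulVec, dotProduct, h]

lemma zOp_mulVec (c : Config Q) (ψ : StateVec Q) (s : Config Q) :
    (zOp c *ᵥ ψ) s = zChar c s * ψ s := by
  simp [zOp, Matrix.mulVec_diagonal]

lemma op_ext {m n : Type} [Fintype n] [DecidableEq n] {A B : Matrix m n ℂ}
    (h : ∀ ψ, A *ᵥ ψ = B *ᵥ ψ) : A = B :=
  Matrix.ext_of_mulVec_single fun i => h (Pi.single i 1)

lemma xOp_mul (c d : Config Q) : xOp c * xOp d = xOp (c + d) := by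
  refine op_ext fun ψ => funext fun s => ?_
  rw [← Matrix.mulVec_mulVec, xOp_mulVec, xOp_mulVec, xOp_mulVec, add_assoc]

lemma zOp_mul (c d : Config Q) : zOp c * zOp d = zOp (c + d) := by
  refine op_ext fun ψ => funext fun s => ?_
  rw [← Matrix.mulVec_mulVec, zOp_mulVec, zOp_mulVec, zOp_mulVec, zChar_add_left, mul_assoc]

@[simp] lemma xOp_zero : xOp (0 : Config Q) = 1 := by
  refine op_ext fun ψ => funext fun s => ?_
  rw [xOp_mulVec, Matrix.one_mulVec, add_zero]

@[simp] lemma zOp_zero : zOp (0 : Config Q) = 1 := by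
  refine op_ext fun ψ => funext fun s => ?_
  rw [zOp_mulVec, Matrix.one_mulVec, zChar_zero_left, one_mul]

lemma xOp_sq (c : Config Q) : xOp c * xOp c = 1 := by
  rw [xOp_mul, config_add_self, xOp_zero]

lemma zOp_sq (c : Config Q) : zOp c * zOp c = 1 := by
  rw [zOp_mul, config_add_self, zOp_zero]

lemma xOp_conjTranspose (c : Config Q) : (xOp c)ᴴ = xOp c := by
  ext s t
  have h : t = s + c ↔ s = t + c :=
    ⟨fun h => by rw [h, config_add_cancel], fun h => by rw [h, config_add_cancel]⟩
  simp only [xOp, Matrix.conjTranspose_apply, Matrix.of_apply, h]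
  split_ifs <;> simp

lemma zOp_conjTranspose (c : Config Q) : (zOp c)ᴴ = zOp c := by
  rw [zOp, Matrix.diagonal_conjTranspose]
  congr 1
  funext s
  exact star_zChar c s

/-- `X` translates and `Z` multiplies by a character, so exchanging them costs the value of the
character at the translation. Every commutation sign below is read off from this. -/
lemma zOp_mulVec_xOp_mulVec (c d : Config Q) (ψ : StateVec Q) :
    zOp d *ᵥ (xOp c *ᵥ ψ) = zChar d c • (xOp c *ᵥ (zOp d *ᵥ ψ)) := by
  funext s
  simp only [zOp_mulVec, xOp_mulVec, Pi.smul_apply, smul_eq_mul, zChar_add_right]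
  rw [← mul_assoc, mul_comm (zChar d c), mul_assoc (zChar d s), zChar_mul_self, mul_one]

lemma pauliX_eq (q : Q) : pauliX q = xOp (Pi.single q 1) := by
  ext s t
  have h : Function.update t q (t q + 1) = t + Pi.single q 1 := by
    funext p
    by_cases hp : p = q
    · subst hp; simp
    · simp [hp]
  simp only [pauliX, xOp, Matrix.of_apply, h]

lemma pauliZ_eq (q : Q) : pauliZ q = zOp (Pi.single q 1) := by
  unfold pauliZ zOp
  congr 1
  funext s
  rw [zChar_single]
  generalize s q = a
  fin_cases a <;> simp [bichar]

end Pauli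

/-! ### Operators acting on a subset of the qubits -/

section Embed

variable {Q : Type} [DecidableEq Q]

/-- The configuration that is `a` on `S` and `s` elsewhere. -/
def override (S : Finset Q) (s : Config Q) (a : S → Fin 2) : Config Q :=
  fun q => if h : q ∈ S then a ⟨q, h⟩ else s q

lemma override_restrict (S : Finset Q) (s : Config Q) (a : S → Fin 2) :
    (fun q : S => override S s a q.1) = a := by
  funext q; simp [override]

lemma override_override (S : Finset Q) (s : Config Q) (a b : S → Fin 2) :
    override S (override S s a) b = override S s b := by
  funext q; by_cases h : q ∈ S <;> simp [override, h]

lemma override_restrict_of_disjoint {S T : Finset Q} (h : Disjoint S T) (s : Config Q)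
    (a : S → Fin 2) : (fun q : T => override S s a q.1) = fun q : T => s q.1 := by
  funext q
  have : q.1 ∉ S := fun hq => Finset.disjoint_left.1 h hq q.2
  simp [override, this]

lemma override_comm {S T : Finset Q} (h : Disjoint S T) (s : Config Q)
    (a : S → Fin 2) (b : T → Fin 2) :
    override T (override S s a) b = override S (override T s b) a := by
  funext q
  by_cases hS : q ∈ S
  · have : q ∉ T := Finset.disjoint_left.1 h hS
    simp [override, hS, this]
  · simp [override, hS]

variable [Fintype Q]

lemma embedOp_mulVec (S : Finset Q) (N : Matrix (S → Fin 2) (S → Fin 2) ℂ) (ψ : StateVec Q)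
    (s : Config Q) :
    (embedOp S N *ᵥ ψ) s = ∑ a, N (fun q => s q.1) a * ψ (override S s a) := by
  symm
  simp only [Matrix.mulVec, dotProduct]
  refine Fintype.sum_of_injective (override S s) ?_ _ _ ?_ ?_
  · intro a b hab
    rw [← override_restrict S s a, hab, override_restrict]
  · intro t ht
    simp only [embedOp, Matrix.of_apply]
    rw [if_neg, zero_mul]
    intro h
    refine ht ⟨fun q => t q.1, ?_⟩
    funext q
    by_cases hq : q ∈ S
    · simp [override, hq]
    · simp [override, hq, h q hq]
  · intro a
    simp only [embedOp, Matrix.of_apply]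
    rw [if_pos, override_restrict]
    intro q hq
    simp [override, hq]

lemma embedOp_mul (S : Finset Q) (N M : Matrix (S → Fin 2) (S → Fin 2) ℂ) :
    embedOp S N * embedOp S M = embedOp S (N * M) := by
  refine op_ext fun ψ => funext fun s => ?_
  rw [← Matrix.mulVec_mulVec, embedOp_mulVec, embedOp_mulVec]
  simp only [embedOp_mulVec, override_restrict, override_override, Matrix.mul_apply,
    Finset.mul_sum, Finset.sum_mul]
  rw [Finset.sum_comm]
  simp only [mul_assoc]

lemma embedOp_one (S : Finset Q) : embedOp S (1 : Matrix (S → Fin 2) (S → Fin 2) ℂ) = 1 := by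
  refine op_ext fun ψ => funext fun s => ?_
  rw [embedOp_mulVec, Matrix.one_mulVec, Finset.sum_eq_single (fun q => s q.1)]
  · rw [Matrix.one_apply_eq, one_mul]
    congr 1
    funext q
    by_cases h : q ∈ S <;> simp [override, h]
  · intro b _ hb
    rw [Matrix.one_apply_ne (Ne.symm hb), zero_mul]
  · simp

lemma embedOp_conjTranspose (S : Finset Q) (N : Matrix (S → Fin 2) (S → Fin 2) ℂ) :
    (embedOp S N)ᴴ = embedOp S Nᴴ := by
  ext s t
  simp only [embedOp, Matrix.conjTranspose_apply, Matrix.of_apply, eq_comm (a := t _)]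
  split_ifs <;> simp

lemma embedOp_commute {S T : Finset Q} (h : Disjoint S T)
    (N : Matrix (S → Fin 2) (S → Fin 2) ℂ) (M : Matrix (T → Fin 2) (T → Fin 2) ℂ) :
    Commute (embedOp S N) (embedOp T M) := by
  refine op_ext fun ψ => funext fun s => ?_
  rw [← Matrix.mulVec_mulVec, ← Matrix.mulVec_mulVec, embedOp_mulVec, embedOp_mulVec]
  simp only [embedOp_mulVec, override_restrict_of_disjoint h,
    override_restrict_of_disjoint h.symm, Finset.mul_sum]
  rw [Finset.sum_comm]
  refine Finset.sum_congr rfl fun b _ => Finset.sum_congr rfl fun a _ => ?_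
  rw [override_comm h]
  ring

lemma xOp_eq_embedOp {S : Finset Q} {c : Config Q} (hc : ∀ q, q ∉ S → c q = 0) :
    xOp c = embedOp S (xOp fun q : S => c q.1) := by
  ext s t
  simp only [xOp, embedOp, Matrix.of_apply, ← ite_and]
  refine if_congr ⟨?_, ?_⟩ rfl rfl
  · rintro rfl
    exact ⟨fun q hq => by simp [hc q hq], rfl⟩
  · rintro ⟨h1, h2⟩
    funext q
    by_cases hq : q ∈ S
    · exact congrFun h2 ⟨q, hq⟩
    · simp [h1 q hq, hc q hq]

lemma zOp_eq_embedOp {S : Finset Q} {c : Config Q} (hc : ∀ q, q ∉ S → c q = 0) :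
    zOp c = embedOp S (zOp fun q : S => c q.1) := by
  refine op_ext fun ψ => funext fun s => ?_
  rw [embedOp_mulVec, zOp_mulVec, Finset.sum_eq_single (fun q => s q.1)]
  · congr 1
    · rw [zOp, Matrix.diagonal_apply_eq, zChar, zChar,
        Finset.prod_coe_sort S (fun q => bichar (c q) (s q))]
      symm
      refine Finset.prod_subset (Finset.subset_univ _) fun q _ hq => ?_
      rw [hc q hq, bichar_zero_left]
    · congr 1
      funext q
      by_cases h : q ∈ S <;> simp [override, h]
  · intro b _ hb
    rw [zOp, Matrix.diagonal_apply_ne _ (Ne.symm hb), zero_mul]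
  · simp

end Embed


/-! ### Supports of operators and their growth under one layer of gates -/

section Locality

variable {Q : Type} [DecidableEq Q] [Fintype Q]

/-- The operator `M` acts trivially on the qubits outside `T`: it commutes with all operators on
these qubits. -/
def SuppOn (T : Set Q) (M : Op Q) : Prop :=
  ∀ (S : Finset Q) (N : Matrix (S → Fin 2) (S → Fin 2) ℂ), (∀ q ∈ S, q ∉ T) →
    Commute M (embedOp S N)

lemma suppOn_xOp {T : Set Q} {c : Config Q} (hc : ∀ q, q ∉ T → c q = 0) : SuppOn T (xOp c) := by
  intro S N hS
  rw [xOp_eq_embedOp (S := Finset.univ.filter fun q => c q ≠ 0) (by simp)]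
  refine embedOp_commute (Finset.disjoint_left.2 fun q hq hqS => ?_) _ _
  exact (Finset.mem_filter.1 hq).2 (hc q (hS q hqS))

lemma suppOn_zOp {T : Set Q} {c : Config Q} (hc : ∀ q, q ∉ T → c q = 0) : SuppOn T (zOp c) := by
  intro S N hS
  rw [zOp_eq_embedOp (S := Finset.univ.filter fun q => c q ≠ 0) (by simp)]
  refine embedOp_commute (Finset.disjoint_left.2 fun q hq hqS => ?_) _ _
  exact (Finset.mem_filter.1 hq).2 (hc q (hS q hqS))

lemma SuppOn.commute_xOp {T : Set Q} {M : Op Q} (hM : SuppOn T M) {c : Config Q}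
    (hc : ∀ q ∈ T, c q = 0) : Commute M (xOp c) := by
  rw [xOp_eq_embedOp (S := Finset.univ.filter fun q => c q ≠ 0) (by simp)]
  exact hM _ _ fun q hq hT => (Finset.mem_filter.1 hq).2 (hc q hT)

lemma SuppOn.commute_zOp {T : Set Q} {M : Op Q} (hM : SuppOn T M) {c : Config Q}
    (hc : ∀ q ∈ T, c q = 0) : Commute M (zOp c) := by
  rw [zOp_eq_embedOp (S := Finset.univ.filter fun q => c q ≠ 0) (by simp)]
  exact hM _ _ fun q hq hT => (Finset.mem_filter.1 hq).2 (hc q hT)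

lemma Gate.embedOp_mul_conjTranspose (g : Gate Q) :
    embedOp g.qubits g.mat * (embedOp g.qubits g.mat)ᴴ = 1 := by
  rw [embedOp_conjTranspose, embedOp_mul, ← Matrix.star_eq_conjTranspose,
    Matrix.mem_unitaryGroup_iff.1 g.unitary, embedOp_one]

lemma layerOp_cons (g : Gate Q) (gates : List (Gate Q)) :
    layerOp (g :: gates) = embedOp g.qubits g.mat * layerOp gates := by
  simp [layerOp]

lemma layerOp_mul_conjTranspose (gates : List (Gate Q)) :
    layerOp gates * (layerOp gates)ᴴ = 1 := by
  induction gates with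
  | nil => simp [layerOp]
  | cons g gates ih =>
    rw [layerOp_cons, Matrix.conjTranspose_mul, Matrix.mul_assoc, ← Matrix.mul_assoc (layerOp gates),
      ih, Matrix.one_mul, g.embedOp_mul_conjTranspose]

lemma circuitOp_mul_conjTranspose (layers : List (List (Gate Q))) :
    circuitOp layers * (circuitOp layers)ᴴ = 1 := by
  induction layers with
  | nil => simp [circuitOp]
  | cons g rest ih =>
    rw [circuitOp, Matrix.conjTranspose_mul, Matrix.mul_assoc, ← Matrix.mul_assoc (layerOp g),
      layerOp_mul_conjTranspose, Matrix.one_mul, ih]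

/-- Conjugation by a layer of disjoint gates enlarges the support of an operator at most by the
gates that meet it. -/
lemma SuppOn.layerOp_conj {T : Set Q} {M : Op Q} (hM : SuppOn T M) :
    ∀ gates : List (Gate Q), (gates.Pairwise fun g h => Disjoint g.qubits h.qubits) →
      SuppOn (T ∪ {q | ∃ g ∈ gates, q ∈ g.qubits ∧ ∃ p ∈ g.qubits, p ∈ T})
        (layerOp gates * M * (layerOp gates)ᴴ) := by
  intro gates
  induction gates with
  | nil =>
    intro _ S N hS
    simpa [layerOp] using hM S N fun q hq hT => hS q hq (Or.inl hT)
  | cons g gates ih =>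
    intro hp S N hS
    obtain ⟨hg, hp⟩ := List.pairwise_cons.1 hp
    set K := layerOp gates * M * (layerOp gates)ᴴ with hK
    set G := embedOp g.qubits g.mat with hG
    have hconj : layerOp (g :: gates) * M * (layerOp (g :: gates))ᴴ = G * K * Gᴴ := by
      rw [layerOp_cons, Matrix.conjTranspose_mul]
      simp only [hK, ← hG, Matrix.mul_assoc]
    have hB : Commute K (embedOp S N) := by
      refine ih hp S N fun q hq hT => hS q hq ?_
      rcases hT with hT | ⟨h, hh, hT⟩
      · exact Or.inl hT
      · exact Or.inr ⟨h, List.mem_cons_of_mem _ hh, hT⟩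
    rw [hconj]
    -- A gate that meets `T` has its qubits included in the new support. A gate that misses `T` is
    -- also disjoint from the other gates, so it commutes with `K` and cancels against its adjoint.
    by_cases ht : ∃ p ∈ g.qubits, p ∈ T
    · have hd : Disjoint g.qubits S := Finset.disjoint_left.2 fun q hq hqS =>
        hS q hqS (Or.inr ⟨g, List.mem_cons_self, hq, ht⟩)
      refine Commute.mul_left (Commute.mul_left (embedOp_commute hd _ _) hB) ?_
      rw [hG, embedOp_conjTranspose]
      exact embedOp_commute hd _ _
    · have hc : Commute K G := by
        refine ih hp _ _ fun q hq hT => ?_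
        rcases hT with hT | ⟨h, hh, hqh, -⟩
        · exact ht ⟨q, hq, hT⟩
        · exact Finset.disjoint_left.1 (hg h hh) hq hqh
      have : G * K * Gᴴ = K := by
        rw [← hc.eq, Matrix.mul_assoc, g.embedOp_mul_conjTranspose, Matrix.mul_one]
      rwa [this]

end Locality

/-! ### The light cone of a circuit on the torus -/

section Torus

variable {L : ℕ}

lemma torusDist_triangle (u v w : Site L) : torusDist u w ≤ torusDist u v + torusDist v w := by
  have h1 := ZMod.natAbs_valMinAbs_add_le (u.1 - v.1) (v.1 - w.1)
  have h2 := ZMod.natAbs_valMinAbs_add_le (u.2 - v.2) (v.2 - w.2)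
  rw [sub_add_sub_cancel] at h1 h2
  have h3 := Int.natAbs_add_le (u.1 - v.1).valMinAbs (v.1 - w.1).valMinAbs
  have h4 := Int.natAbs_add_le (u.2 - v.2).valMinAbs (v.2 - w.2).valMinAbs
  unfold torusDist
  omega

lemma torusDist_self (u : Site L) : torusDist u u = 0 := by simp [torusDist]

variable [NeZero L] {anc : Site L → ℕ}

/-- The qubits at distance at most `k` from the site `v`. -/
def qubitBall (anc : Site L → ℕ) (v : Site L) (k : ℕ) : Set (Qubit L anc) :=
  {q | torusDist (siteOf q) v ≤ k}

/-- The light cone of a circuit. -/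
lemma SuppOn.circuitOp_conj {v : Site L} {ρ : ℕ} :
    ∀ (layers : List (List (Gate (Qubit L anc)))) (k : ℕ) (M : Op (Qubit L anc)),
      (∀ gates ∈ layers, gates.Pairwise fun g h => Disjoint g.qubits h.qubits) →
      (∀ gates ∈ layers, ∀ g ∈ gates, ∀ q ∈ g.qubits, ∀ q' ∈ g.qubits,
        torusDist (siteOf q) (siteOf q') ≤ ρ) →
      SuppOn (qubitBall anc v k) M →
      SuppOn (qubitBall anc v (k + ρ * layers.length))
        (circuitOp layers * M * (circuitOp layers)ᴴ) := by
  intro layers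
  induction layers with
  | nil => intro k M _ _ hM; simpa [circuitOp] using hM
  | cons gates rest ih =>
    intro k M hd hr hM
    have h1 : SuppOn (qubitBall anc v (k + ρ)) (layerOp gates * M * (layerOp gates)ᴴ) := by
      intro S N hS
      refine hM.layerOp_conj gates (hd gates List.mem_cons_self) S N fun q hq hT => hS q hq ?_
      rcases hT with hT | ⟨g, hg, hqg, p, hp, hpT⟩
      · exact le_trans hT (Nat.le_add_right _ _)
      · have h2 := hr gates List.mem_cons_self g hg q hqg p hp
        have h3 := torusDist_triangle (siteOf q) (siteOf p) v
        have h4 : torusDist (siteOf p) v ≤ k := hpT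
        change torusDist (siteOf q) v ≤ k + ρ
        omega
    have h2 := ih (k + ρ) _ (fun g hg => hd g (List.mem_cons_of_mem _ hg))
      (fun g hg => hr g (List.mem_cons_of_mem _ hg)) h1
    have e1 : k + ρ * (gates :: rest).length = k + ρ + ρ * rest.length := by
      rw [List.length_cons]; ring
    have e2 : circuitOp (gates :: rest) * M * (circuitOp (gates :: rest))ᴴ =
        circuitOp rest * (layerOp gates * M * (layerOp gates)ᴴ) * (circuitOp rest)ᴴ := by
      simp only [circuitOp, Matrix.conjTranspose_mul, Matrix.mul_assoc]
    rw [e1, e2]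
    exact h2

end Torus


/-! ### Supports of positive operators, and when Kraus operators give a unitary channel -/

section LinearAlgebra

open scoped ComplexOrder

variable {n : Type} [Fintype n] [DecidableEq n]

lemma exists_projection (V : Submodule ℂ (n → ℂ)) :
    ∃ P : Matrix n n ℂ, Pᴴ = P ∧ (∀ v, P *ᵥ v ∈ V) ∧ ∀ v ∈ V, P *ᵥ v = v := by
  let V' : Submodule ℂ (EuclideanSpace ℂ n) :=
    V.comap (WithLp.linearEquiv 2 ℂ (n → ℂ)).toLinearMap
  let P : Matrix n n ℂ := Matrix.toEuclideanLin.symm V'.starProjection.toLinearMap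
  have hP : ∀ v : n → ℂ, P *ᵥ v = (V'.starProjection (WithLp.toLp 2 v)).ofLp := by
    intro v
    have : Matrix.toEuclideanLin P (WithLp.toLp 2 v) = V'.starProjection (WithLp.toLp 2 v) := by
      simp only [P, LinearEquiv.apply_symm_apply]
      rfl
    rw [← this, Matrix.toLpLin_apply]
  refine ⟨P, ?_, fun v => ?_, fun v hv => ?_⟩
  · have : P.IsHermitian := by
      rw [← Matrix.isSymmetric_toEuclideanLin_iff]
      simp only [P, LinearEquiv.apply_symm_apply]
      exact V'.starProjection_isSymmetric
    exact this
  · rw [hP]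
    exact V'.starProjection_apply_mem _
  · rw [hP, Submodule.starProjection_eq_self_iff.2]
    exact hv

/-- Expand in an eigenbasis: the components with eigenvalue zero are killed, the others lie in the
support. -/
lemma mulVec_mem_supp {Q : Type} [DecidableEq Q] [Fintype Q] {K : Op Q} (hK : K.PosSemidef)
    (v : StateVec Q) : K *ᵥ v ∈ supp K := by
  have hv := hK.1.eigenvectorBasis.sum_repr (WithLp.toLp 2 v)
  have hv' : v = ∑ i, hK.1.eigenvectorBasis.repr (WithLp.toLp 2 v) i •
      (hK.1.eigenvectorBasis i).ofLp := by
    have := congrArg WithLp.ofLp hv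
    simpa [WithLp.ofLp_sum] using this.symm
  rw [hv', Matrix.mulVec_sum]
  refine Submodule.sum_mem _ fun i _ => ?_
  rw [Matrix.mulVec_smul]
  refine Submodule.smul_mem _ _ ?_
  rw [hK.1.mulVec_eigenvectorBasis]
  rcases (hK.eigenvalues_nonneg i).eq_or_lt with h | h
  · rw [← h, zero_smul]
    exact Submodule.zero_mem _
  · refine Submodule.smul_of_tower_mem _ _ (Submodule.subset_span ⟨hK.1.eigenvalues i, h, ?_⟩)
    rw [hK.1.mulVec_eigenvectorBasis]
    rfl

lemma ketbra_conj {Q : Type} [DecidableEq Q] [Fintype Q] (A : Op Q) (ψ : StateVec Q) :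
    A * ketbra ψ * Aᴴ = ketbra (A *ᵥ ψ) := by
  rw [ketbra, ketbra, Matrix.mul_vecMulVec, Matrix.vecMulVec_mul, Matrix.star_mulVec]

/-- If the support of a sum of rank one operators is fixed by `S`, so is each of the vectors. -/
lemma fixed_of_supp_sum {Q E : Type} [DecidableEq Q] [Fintype Q] [Fintype E]
    (a : E → StateVec Q) (S : Op Q)
    (h : ∀ v ∈ supp (∑ e, ketbra (a e)), S *ᵥ v = v) (e : E) : S *ᵥ a e = a e := by
  have hK : (∑ e, ketbra (a e)).PosSemidef :=
    Matrix.posSemidef_sum _ fun e _ => Matrix.posSemidef_vecMulVec_self_star (a e)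
  have h1 : (S - 1) * ∑ e, ketbra (a e) = 0 := by
    refine op_ext fun v => ?_
    rw [← Matrix.mulVec_mulVec, Matrix.sub_mulVec, h _ (mulVec_mem_supp hK v), Matrix.one_mulVec,
      sub_self, Matrix.zero_mulVec]
  -- Conjugation by `S - 1` keeps the sum positive term by term, so no cancellation is possible:
  -- each diagonal entry is a sum of squared moduli.
  have h2 : ∑ e, ketbra ((S - 1) *ᵥ a e) = 0 := by
    simp only [← ketbra_conj]
    rw [← Finset.sum_mul, ← Finset.mul_sum, h1, Matrix.zero_mul]
  have h3 : (S - 1) *ᵥ a e = 0 := by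
    funext s
    have h4 := congrFun (congrFun h2 s) s
    simp only [Matrix.sum_apply, ketbra, Matrix.vecMulVec_apply, Pi.star_apply,
      RCLike.star_def, Complex.mul_conj, Matrix.zero_apply] at h4
    have h5 : ∑ e, Complex.normSq (((S - 1) *ᵥ a e) s) = 0 := by exact_mod_cast h4
    exact Complex.normSq_eq_zero.1
      ((Finset.sum_eq_zero_iff_of_nonneg fun _ _ => Complex.normSq_nonneg _).1 h5 e
        (Finset.mem_univ e))
  rwa [Matrix.sub_mulVec, Matrix.one_mulVec, sub_eq_zero] at h3

/-- Operators `D e` on the range of the projection `P` with `∑ Dᴴ D = P`, such that all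
`D e Dᴴ f` are multiples of `P`, are multiples of a single unitary. -/
lemma sum_conj_eq_unitary {E : Type} [Fintype E] {P : Matrix n n ℂ} (hP : Pᴴ = P)
    (hPP : P * P = P) (D : E → Matrix n n ℂ) (hPD : ∀ e, P * D e = D e)
    (hDP : ∀ e, D e * P = D e) (hD : ∑ e, (D e)ᴴ * D e = P)
    (hs : ∀ e f, ∃ c : ℂ, D e * (D f)ᴴ = c • P) :
    ∃ W ∈ Matrix.unitaryGroup n ℂ, P * W * P = W * P ∧
      ∀ X, P * X = X → X * P = X → ∑ e, D e * X * (D e)ᴴ = W * X * Wᴴ := by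
  by_cases hP0 : P = 0
  · refine ⟨1, one_mem _, by simp [hP0], fun X hX _ => ?_⟩
    have : X = 0 := by rw [← hX, hP0, Matrix.zero_mul]
    simp [this]
  obtain ⟨e₀, he₀⟩ : ∃ e, D e ≠ 0 := by
    by_contra! h
    exact hP0 (by rw [← hD]; simp [h])
  obtain ⟨c, hc⟩ := hs e₀ e₀
  obtain ⟨i, hi⟩ : ∃ i, P i i ≠ 0 := by
    by_contra! h
    refine hP0 ?_
    rw [← Matrix.trace_conjTranspose_mul_self_eq_zero_iff, hP, hPP]
    simp [Matrix.trace, h]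
  have hdiag : ∀ A : Matrix n n ℂ, ∃ x : ℝ, 0 ≤ x ∧ (A * Aᴴ) i i = x := by
    intro A
    refine ⟨∑ j, Complex.normSq (A i j), Finset.sum_nonneg fun _ _ => Complex.normSq_nonneg _, ?_⟩
    simp [Matrix.mul_apply, Complex.mul_conj]
  -- The scalar is a quotient of diagonal entries of the positive operators `D e₀ (D e₀)ᴴ` and `P
  -- P`; it is nonzero because `D e₀` is.
  obtain ⟨γ, hγ, hcγ⟩ : ∃ γ : ℝ, 0 < γ ∧ c = γ := by
    obtain ⟨x, hx, hx'⟩ := hdiag P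
    obtain ⟨y, hy, hy'⟩ := hdiag (D e₀)
    rw [hP, hPP] at hx'
    rw [hc, Matrix.smul_apply, hx', smul_eq_mul] at hy'
    have hx0 : x ≠ 0 := by rintro rfl; exact hi (by simpa using hx')
    have hcxy : c = ((y / x : ℝ) : ℂ) := by
      rw [Complex.ofReal_div, ← hy', mul_div_cancel_right₀ _ (by exact_mod_cast hx0)]
    refine ⟨y / x, lt_of_le_of_ne (div_nonneg hy hx) fun h => he₀ ?_, hcxy⟩
    rw [← Matrix.trace_mul_conjTranspose_self_eq_zero_iff, hc, hcxy, ← h]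
    simp
  set W₀ : Matrix n n ℂ := ((Real.sqrt γ : ℝ) : ℂ)⁻¹ • D e₀ with hW₀
  have hγ' : ((Real.sqrt γ : ℝ) : ℂ) * ((Real.sqrt γ : ℝ) : ℂ) = γ := by
    rw [← Complex.ofReal_mul, Real.mul_self_sqrt hγ.le]
  have hγ0 : ((Real.sqrt γ : ℝ) : ℂ) ≠ 0 := by
    exact_mod_cast (Real.sqrt_pos.2 hγ).ne'
  have hW₀P : W₀ * P = W₀ := by rw [hW₀, Matrix.smul_mul, hDP]
  have hPW₀ : P * W₀ = W₀ := by rw [hW₀, Matrix.mul_smul, hPD]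
  have hW₀s : W₀ᴴ = ((Real.sqrt γ : ℝ) : ℂ)⁻¹ • (D e₀)ᴴ := by
    rw [hW₀, Matrix.conjTranspose_smul]
    simp
  have hW₀W₀ : W₀ * W₀ᴴ = P := by
    rw [hW₀s, hW₀, Matrix.smul_mul, Matrix.mul_smul, hc, hcγ, smul_smul, smul_smul, ← hγ']
    field_simp
    simp
  have hPW₀s : P * W₀ᴴ = W₀ᴴ := by
    have := congrArg Matrix.conjTranspose hW₀P
    rwa [Matrix.conjTranspose_mul, hP] at this
  have hW₀sP : W₀ᴴ * P = W₀ᴴ := by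
    have := congrArg Matrix.conjTranspose hPW₀
    rwa [Matrix.conjTranspose_mul, hP] at this
  -- `W₀` is unitary on the range of `P`; the identity on the complement completes it.
  set W : Matrix n n ℂ := W₀ + (1 - P) with hW
  have hWs : Wᴴ = W₀ᴴ + (1 - P) := by
    rw [hW, Matrix.conjTranspose_add, Matrix.conjTranspose_sub, Matrix.conjTranspose_one, hP]
  have hWW : W * Wᴴ = 1 := by
    rw [hWs, hW]
    simp only [mul_add, add_mul, mul_sub, sub_mul, mul_one, one_mul, hW₀W₀, hW₀P, hPW₀s, hPP]
    abel
  have hWW' : Wᴴ * W = 1 := mul_eq_one_comm.1 hWW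
  have hWP : W * P = W₀ := by
    rw [hW, add_mul, sub_mul, one_mul, hPP, sub_self, add_zero, hW₀P]
  have hPWs : P * Wᴴ = W₀ᴴ := by
    rw [hWs, mul_add, mul_sub, mul_one, hPP, sub_self, add_zero, hPW₀s]
  -- Inserting `Wᴴ W = 1` after `D e` produces `D e (D e₀)ᴴ`, which is a multiple of `P`.
  have hDW : ∀ e, ∃ d : ℂ, D e = d • (W * P) := by
    intro e
    obtain ⟨d, hd⟩ := hs e e₀
    refine ⟨((Real.sqrt γ : ℝ) : ℂ)⁻¹ * d, ?_⟩
    calc D e = D e * P * (Wᴴ * W) := by rw [hWW', mul_one, hDP]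
      _ = D e * (P * Wᴴ) * W := by simp only [mul_assoc]
      _ = (((Real.sqrt γ : ℝ) : ℂ)⁻¹ * d) • (P * W) := by
        rw [hPWs, hW₀s, Matrix.mul_smul, hd, smul_smul, Matrix.smul_mul]
      _ = _ := by rw [hWP, hW, mul_add, hPW₀, mul_sub, mul_one, hPP, sub_self, add_zero]
  choose d hd using hDW
  have hsum : ∑ e, d e * star (d e) = 1 := by
    have h1 : (∑ e, d e * star (d e)) • P = P := by
      rw [Finset.sum_smul]
      conv_rhs => rw [← hD]
      refine Finset.sum_congr rfl fun e _ => ?_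
      rw [hd e, Matrix.conjTranspose_smul, Matrix.conjTranspose_mul, hP, Matrix.smul_mul,
        Matrix.mul_smul, mul_assoc, ← mul_assoc Wᴴ, hWW', one_mul, hPP, smul_smul, mul_comm]
    have h2 := congrFun (congrFun h1 i) i
    rw [Matrix.smul_apply, smul_eq_mul] at h2
    exact mul_right_cancel₀ hi (by rw [h2, one_mul])
  refine ⟨W, Matrix.mem_unitaryGroup_iff.2 hWW, by rw [mul_assoc, hWP, hPW₀], fun X hX hX' => ?_⟩
  calc ∑ e, D e * X * (D e)ᴴ = ∑ e, (d e * star (d e)) • (W * X * Wᴴ) := by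
        refine Finset.sum_congr rfl fun e _ => ?_
        rw [hd e, Matrix.conjTranspose_smul, Matrix.conjTranspose_mul, hP, Matrix.smul_mul,
          Matrix.mul_smul, Matrix.smul_mul, smul_smul, mul_assoc W P X, hX, ← mul_assoc (W * X),
          mul_assoc W X P, hX', mul_comm]
    _ = W * X * Wᴴ := by rw [← Finset.sum_smul, hsum, one_smul]

/-- If Kraus operators preserve `V` and intertwine a set of Hermitian operators that is irreducible
on `V` with operators on `V`, they define a unitary channel of `V`. -/
lemma actsAsUnitary_of_kraus {Q E : Type} [DecidableEq Q] [Fintype Q] [Fintype E]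
    (V : Submodule ℂ (StateVec Q)) (T : E → Op Q) (hT : ∑ e, (T e)ᴴ * T e = 1)
    (hTV : ∀ e, ∀ ψ ∈ V, T e *ᵥ ψ ∈ V) (𝒪 : Set (Op Q)) (hO : ∀ O ∈ 𝒪, Oᴴ = O)
    (hOT : ∀ O ∈ 𝒪, ∀ ψ ∈ V, ∃ φ ∈ V, ∀ e, O *ᵥ (T e *ᵥ ψ) = T e *ᵥ φ)
    (hirr : ∀ M : Op Q, (∀ ψ ∈ V, M *ᵥ ψ ∈ V) →
      (∀ O ∈ 𝒪, ∀ ψ ∈ V, M *ᵥ (O *ᵥ ψ) = O *ᵥ (M *ᵥ ψ)) → ∃ c : ℂ, ∀ ψ ∈ V, M *ᵥ ψ = c • ψ) :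
    ActsAsUnitaryChannelOn V fun X => ∑ e, T e * X * (T e)ᴴ := by
  obtain ⟨P, hP, hPV, hPid⟩ := exists_projection V
  have hfix : ∀ A : Op Q, (∀ v, A *ᵥ v ∈ V) → P * A = A := fun A hA =>
    op_ext fun v => by rw [← Matrix.mulVec_mulVec, hPid _ (hA v)]
  have hPP : P * P = P := hfix P hPV
  have hmem : ∀ {A : Op Q}, (∀ ψ ∈ V, A *ᵥ ψ ∈ V) → P * (A * P) = A * P := fun {A} hA =>
    hfix _ fun v => by rw [← Matrix.mulVec_mulVec]; exact hA _ (hPV v)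
  obtain ⟨D, hD⟩ : ∃ D : E → Op Q, ∀ e, D e = T e * P := ⟨_, fun _ => rfl⟩
  have hPD : ∀ e, P * D e = D e := fun e => by rw [hD]; exact hmem (hTV e)
  have hDP : ∀ e, D e * P = D e := fun e => by rw [hD, mul_assoc, hPP]
  have hDsum : ∑ e, (D e)ᴴ * D e = P := by
    calc ∑ e, (D e)ᴴ * D e = P * (∑ e, (T e)ᴴ * T e) * P := by
          rw [Finset.mul_sum, Finset.sum_mul]
          refine Finset.sum_congr rfl fun e _ => ?_
          simp only [hD, Matrix.conjTranspose_mul, hP, mul_assoc]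
      _ = P := by rw [hT, mul_one, hPP]
  have hcomm : ∀ O ∈ 𝒪, ∀ e f, O * (D e * (D f)ᴴ) = D e * (D f)ᴴ * O := by
    intro O hOm e f
    -- Since `φ` serves all `g` at once, `∑ (D g)ᴴ D g = P` recovers it from `ψ` by one operator.
    -- This formula makes `Φ` visibly Hermitian, so the relation `O D = D Φ` may be conjugated.
    set Φ : Op Q := ∑ g, (D g)ᴴ * O * D g with hΦ
    have hΦs : Φᴴ = Φ := by
      simp only [hΦ, Matrix.conjTranspose_sum, Matrix.conjTranspose_mul, hO O hOm,
        Matrix.conjTranspose_conjTranspose, mul_assoc]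
    have hint : ∀ g, O * D g = D g * Φ := by
      intro g
      refine op_ext fun v => ?_
      obtain ⟨φ, hφ, h⟩ := hOT O hOm (P *ᵥ v) (hPV v)
      have h1 : ∀ g, O *ᵥ (D g *ᵥ v) = D g *ᵥ φ := fun g => by
        simp only [hD, ← Matrix.mulVec_mulVec, h g, hPid φ hφ]
      have h2 : Φ *ᵥ v = φ := by
        simp only [hΦ, Matrix.sum_mulVec, mul_assoc, ← Matrix.mulVec_mulVec, h1]
        simp only [Matrix.mulVec_mulVec, ← Matrix.sum_mulVec, hDsum, hPid φ hφ]
      rw [← Matrix.mulVec_mulVec, ← Matrix.mulVec_mulVec, h1, h2]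
    have hint' : (D f)ᴴ * O = Φ * (D f)ᴴ := by
      have := congrArg Matrix.conjTranspose (hint f)
      rwa [Matrix.conjTranspose_mul, Matrix.conjTranspose_mul, hΦs, hO O hOm] at this
    rw [← mul_assoc, hint, mul_assoc, mul_assoc, hint']
  obtain ⟨W, hW, hWP, hsum⟩ := sum_conj_eq_unitary hP hPP D hPD hDP hDsum (by
    intro e f
    obtain ⟨c, hc⟩ := hirr (D e * (D f)ᴴ)
      (fun ψ _ => by rw [← hPD, mul_assoc, ← Matrix.mulVec_mulVec]; exact hPV _)
      (fun O hOm ψ _ => by rw [Matrix.mulVec_mulVec, Matrix.mulVec_mulVec, hcomm O hOm])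
    refine ⟨c, op_ext fun v => ?_⟩
    have hDsP : (D f)ᴴ * P = (D f)ᴴ := by
      have := congrArg Matrix.conjTranspose (hPD f)
      rwa [Matrix.conjTranspose_mul, hP] at this
    rw [Matrix.smul_mulVec, ← hc _ (hPV v), Matrix.mulVec_mulVec, mul_assoc, hDsP])
  refine ⟨W, hW, fun ψ hψ => ?_, fun X hX => ?_⟩
  · rw [← hPid ψ hψ, Matrix.mulVec_mulVec, ← hWP, mul_assoc, ← Matrix.mulVec_mulVec]
    exact hPV _
  · have h1 : P * X = X := hfix X hX.1
    have h2 : X * P = X := by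
      have := congrArg Matrix.conjTranspose (hfix Xᴴ hX.2)
      rwa [Matrix.conjTranspose_mul, hP, Matrix.conjTranspose_conjTranspose] at this
    rw [← hsum X h1 h2]
    refine Finset.sum_congr rfl fun e _ => ?_
    simp only [hD, Matrix.conjTranspose_mul, hP, mul_assoc]
    rw [← mul_assoc P X, h1, ← mul_assoc X P, h2]

end LinearAlgebra


/-! ### Summation around a cycle -/

section Cyclic

variable {L : ℕ} [NeZero L]

lemma zmod_const_of_sub_one {α : Type} (h : ZMod L → α) (hh : ∀ y, h y = h (y - 1)) (y : ZMod L) :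
    h y = h 0 := by
  have key : ∀ k : ℕ, h (k : ZMod L) = h 0 := by
    intro k
    induction k with
    | zero => simp
    | succ k ih => rw [hh, ← ih]; congr 1; push_cast; ring
  rw [← key y.val, ZMod.natCast_zmod_val]

/-- Partial sums give the primitive; the vanishing total makes it close up at the wrap-around from
`L - 1` to `0`. -/
lemma zmod_exists_primitive {A : Type} [AddCommGroup A] (f : ZMod L → A) (hf : ∑ x, f x = 0) :
    ∃ F : ZMod L → A, F 0 = 0 ∧ ∀ x, F x = F (x - 1) + f x := by
  set G : ℕ → A := fun k => ∑ i ∈ Finset.range k, f ((i : ZMod L) + 1) with hG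
  have hGL : G L = 0 := by
    rw [← hf, ← Equiv.sum_comp (Equiv.addRight (1 : ZMod L)) f]
    refine Finset.sum_nbij' (fun i : ℕ => (i : ZMod L)) ZMod.val ?_ ?_ ?_ ?_ ?_
    · simp
    · intro a _; exact Finset.mem_range.2 (ZMod.val_lt a)
    · intro i hi; exact ZMod.val_cast_of_lt (Finset.mem_range.1 hi)
    · intro a _; exact ZMod.natCast_zmod_val a
    · intro i _; rfl
  refine ⟨fun x => G x.val, by simp [hG], fun x => ?_⟩
  have hk : (x - 1).val < L := ZMod.val_lt _
  have hx : (((x - 1).val + 1 : ℕ) : ZMod L) = x := by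
    push_cast
    rw [ZMod.natCast_zmod_val, sub_add_cancel]
  have h1 : G ((x - 1).val + 1) = G (x - 1).val + f x := by
    simp only [hG, Finset.sum_range_succ]
    rw [ZMod.natCast_zmod_val, sub_add_cancel]
  change G x.val = G (x - 1).val + f x
  rw [← h1]
  rcases (Nat.succ_le_of_lt hk).lt_or_eq with h | h
  · conv_lhs => rw [← hx, ZMod.val_cast_of_lt h]
  · have h' : (x - 1).val + 1 = L := h
    have hx0 : x = 0 := by rw [← hx, h', ZMod.natCast_self]
    rw [h', hGL, hx0, ZMod.val_zero]
    simp [hG]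

end Cyclic

/-! ### Cycles and boundaries on the torus over `ℤ/2` -/

section Chains

variable {L : ℕ} [NeZero L]

lemma fin_two_add_self (a : Fin 2) : a + a = 0 := by revert a; decide

/-- The boundary of the plaquette `v`. -/
def plaqVec (v : Site L) : Config (Link L) :=
  Pi.single (v, 0) 1 + Pi.single (v + (0, 1), 0) 1 + Pi.single (v, 1) 1 +
    Pi.single (v + (1, 0), 1) 1

/-- The links that meet at the vertex `v`. -/
def starVec (v : Site L) : Config (Link L) :=
  Pi.single (v, 0) 1 + Pi.single (v - (1, 0), 0) 1 + Pi.single (v, 1) 1 +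
    Pi.single (v - (0, 1), 1) 1

/-- The links of direction `d` at the sites of the row `y`. -/
def rowLine (d : Fin 2) (y : ZMod L) : Config (Link L) := ∑ x : ZMod L, Pi.single ((x, y), d) 1

/-- The links of direction `d` at the sites of the column `x`. -/
def colLine (d : Fin 2) (x : ZMod L) : Config (Link L) := ∑ y : ZMod L, Pi.single ((x, y), d) 1

lemma rowLine_apply (d : Fin 2) (y : ZMod L) (l : Link L) :
    rowLine d y l = if l.1.2 = y ∧ l.2 = d then 1 else 0 := by
  obtain ⟨⟨a, b⟩, i⟩ := l
  simp only [rowLine, Finset.sum_apply, Pi.single_apply, Prod.mk.injEq, and_assoc, ite_and]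
  rw [Finset.sum_ite_eq]
  simp

lemma colLine_apply (d : Fin 2) (x : ZMod L) (l : Link L) :
    colLine d x l = if l.1.1 = x ∧ l.2 = d then 1 else 0 := by
  obtain ⟨⟨a, b⟩, i⟩ := l
  by_cases h : a = x
  · simp only [colLine, Finset.sum_apply, Pi.single_apply, Prod.mk.injEq, h, true_and,
      ite_and]
    rw [Finset.sum_ite_eq]
    simp
  · simp [colLine, h]

lemma zChar_rowLine (d : Fin 2) (y : ZMod L) (s : Config (Link L)) :
    zChar (rowLine d y) s = bichar 1 (∑ x, s ((x, y), d)) := by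
  rw [rowLine, zChar_sum_left, bichar_sum]
  exact Finset.prod_congr rfl fun x _ => zChar_single _ _

lemma zChar_colLine (d : Fin 2) (x : ZMod L) (s : Config (Link L)) :
    zChar (colLine d x) s = bichar 1 (∑ y, s ((x, y), d)) := by
  rw [colLine, zChar_sum_left, bichar_sum]
  exact Finset.prod_congr rfl fun x _ => zChar_single _ _

lemma zChar_starVec (v : Site L) (s : Config (Link L)) :
    zChar (starVec v) s =
      bichar 1 (s (v, 0) + s (v - (1, 0), 0) + s (v, 1) + s (v - (0, 1), 1)) := by
  simp only [starVec, zChar_add_left, zChar_single, bichar_add_right]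

lemma zChar_plaqVec (v : Site L) (s : Config (Link L)) :
    zChar (plaqVec v) s =
      bichar 1 (s (v, 0) + s (v + (0, 1), 0) + s (v, 1) + s (v + (1, 0), 1)) := by
  simp only [plaqVec, zChar_add_left, zChar_single, bichar_add_right]

/-- Neighbouring plaquettes of a row share a vertical link, which cancels mod 2. This is what moves
`X` loops across the torus; star sums do the same for `Z` loops. -/
lemma sum_plaqVec_row (y : ZMod L) :
    ∑ x : ZMod L, plaqVec (x, y) = rowLine 0 y + rowLine 0 (y + 1) := by
  have h : ∑ x : ZMod L, (Pi.single ((x + 1, y), 1) 1 : Config (Link L)) = rowLine 1 y :=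
    Equiv.sum_comp (Equiv.addRight (1 : ZMod L))
      fun x => (Pi.single ((x, y), 1) 1 : Config (Link L))
  simp only [plaqVec, Prod.mk_add_mk, add_zero, Finset.sum_add_distrib, h]
  change rowLine 0 y + rowLine 0 (y + 1) + rowLine 1 y + rowLine 1 y = _
  rw [config_add_cancel]

lemma sum_plaqVec_col (x : ZMod L) :
    ∑ y : ZMod L, plaqVec (x, y) = colLine 1 x + colLine 1 (x + 1) := by
  have h : ∑ y : ZMod L, (Pi.single ((x, y + 1), 0) 1 : Config (Link L)) = colLine 0 x :=
    Equiv.sum_comp (Equiv.addRight (1 : ZMod L))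
      fun y => (Pi.single ((x, y), 0) 1 : Config (Link L))
  simp only [plaqVec, Prod.mk_add_mk, add_zero, Finset.sum_add_distrib, h]
  change colLine 0 x + colLine 0 x + colLine 1 x + colLine 1 (x + 1) = _
  rw [config_add_self, zero_add]

lemma sum_starVec_row (y : ZMod L) :
    ∑ x : ZMod L, starVec (x, y) = rowLine 1 y + rowLine 1 (y - 1) := by
  have h : ∑ x : ZMod L, (Pi.single ((x - 1, y), 0) 1 : Config (Link L)) = rowLine 0 y :=
    Equiv.sum_comp (Equiv.subRight (1 : ZMod L))
      fun x => (Pi.single ((x, y), 0) 1 : Config (Link L))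
  simp only [starVec, Prod.mk_sub_mk, sub_zero, Finset.sum_add_distrib, h]
  change rowLine 0 y + rowLine 0 y + rowLine 1 y + rowLine 1 (y - 1) = _
  rw [config_add_self, zero_add]

lemma sum_starVec_col (x : ZMod L) :
    ∑ y : ZMod L, starVec (x, y) = colLine 0 x + colLine 0 (x - 1) := by
  have h : ∑ y : ZMod L, (Pi.single ((x, y - 1), 1) 1 : Config (Link L)) = colLine 1 x :=
    Equiv.sum_comp (Equiv.subRight (1 : ZMod L))
      fun y => (Pi.single ((x, y), 1) 1 : Config (Link L))
  simp only [starVec, Prod.mk_sub_mk, sub_zero, Finset.sum_add_distrib, h]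
  change colLine 0 x + colLine 0 (x - 1) + colLine 1 x + colLine 1 x = _
  rw [config_add_cancel]

/-- A cycle on the torus with trivial winding numbers is a boundary. -/
lemma mem_of_closed (H : AddSubgroup (Config (Link L))) (hH : ∀ v, plaqVec v ∈ H)
    (s : Config (Link L))
    (hs : ∀ v, s (v, 0) + s (v - (1, 0), 0) + s (v, 1) + s (v - (0, 1), 1) = 0)
    (hrow : ∑ x : ZMod L, s ((x, 0), 1) = 0) (hcol : ∑ y : ZMod L, s ((0, y), 0) = 0) :
    s ∈ H := by
  have two : ∀ a : Fin 2, a + a = 0 := fin_two_add_self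
  -- Summing the cycle condition over a column cancels the vertical links, so adjacent columns carry
  -- the same winding number.
  have hcol' : ∀ x : ZMod L, ∑ y : ZMod L, s ((x, y), 0) = 0 := by
    intro x
    refine (zmod_const_of_sub_one (fun x : ZMod L => ∑ y : ZMod L, s ((x, y), 0))
      (fun x => ?_) x).trans hcol
    have h1 : ∑ y : ZMod L, (s ((x, y), 0) + s ((x - 1, y), 0) + s ((x, y), 1) +
        s ((x, y - 1), 1)) = 0 := Finset.sum_eq_zero fun y _ => by
      have := hs (x, y)
      simpa only [Prod.mk_sub_mk, sub_zero] using this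
    have h2 : ∑ y : ZMod L, s ((x, y - 1), 1) = ∑ y : ZMod L, s ((x, y), 1) :=
      Equiv.sum_comp (Equiv.subRight (1 : ZMod L)) fun y => s ((x, y), 1)
    simp only [Finset.sum_add_distrib, h2] at h1
    rw [add_assoc, two, add_zero] at h1
    calc ∑ y : ZMod L, s ((x, y), 0)
        = (∑ y : ZMod L, s ((x, y), 0) + ∑ y : ZMod L, s ((x - 1, y), 0)) +
          ∑ y : ZMod L, s ((x - 1, y), 0) := by rw [add_assoc, two, add_zero]
      _ = ∑ y : ZMod L, s ((x - 1, y), 0) := by rw [h1, zero_add]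
  obtain ⟨B, hB0, hB⟩ := zmod_exists_primitive (fun x : ZMod L => s ((x, 0), 1)) hrow
  choose A hA0 hA using fun x : ZMod L =>
    zmod_exists_primitive (fun y : ZMod L => s ((x, y), 0)) (hcol' x)
  -- The plaquettes to be summed: their indicator is integrated along row `0` by `B`, then up each
  -- column by `A`.
  set p : Site L → Fin 2 := fun v => B v.1 + A v.1 v.2 with hp
  have hp0 : ∀ v : Site L, p v + p (v - (0, 1)) = s (v, 0) := by
    rintro ⟨x, y⟩
    simp only [hp, Prod.mk_sub_mk, sub_zero]
    rw [hA x y]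
    generalize B x = a
    generalize A x (y - 1) = b
    generalize s ((x, y), 0) = c
    revert a b c
    decide
  have hp1 : ∀ v : Site L, p v + p (v - (1, 0)) = s (v, 1) := by
    rintro ⟨x, y⟩
    -- The defect on vertical links is independent of `y` by the cycle condition, and vanishes at `y
    -- = 0` by the choice of `B`.
    have hk := zmod_const_of_sub_one
      (fun y : ZMod L => p (x, y) + p (x - 1, y) + s ((x, y), 1)) (fun y => by
        have h1 := hp0 (x, y)
        have h2 := hp0 (x - 1, y)
        have h3 := hs (x, y)
        simp only [Prod.mk_sub_mk, sub_zero] at h1 h2 h3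
        rw [← h1, ← h2] at h3
        revert h3
        generalize p (x, y) = a
        generalize p (x - 1, y) = b
        generalize p (x, y - 1) = c
        generalize p (x - 1, y - 1) = d
        generalize s ((x, y), 1) = e
        generalize s ((x, y - 1), 1) = f
        revert a b c d e f
        decide) y
    simp only [hp, hA0, hB x, Prod.mk_sub_mk, sub_zero] at hk ⊢
    revert hk
    generalize B (x - 1) = a
    generalize A x y = b
    generalize A (x - 1) y = c
    generalize s ((x, y), 1) = d
    generalize s ((x, 0), 1) = e
    revert a b c d e
    decide
  have hsum : s = ∑ v : Site L, (Pi.single (v, 0) (p v) + Pi.single (v + (0, 1), 0) (p v) +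
      Pi.single (v, 1) (p v) + Pi.single (v + (1, 0), 1) (p v) : Config (Link L)) := by
    have e : ∀ (w u v : Site L), w = v + u ↔ v = w - u := fun w u v =>
      ⟨fun h => by rw [h, add_sub_cancel_right], fun h => by rw [h, sub_add_cancel]⟩
    funext l
    obtain ⟨w, i⟩ := l
    simp only [Finset.sum_apply, Pi.add_apply, Pi.single_apply, Prod.mk.injEq, ite_and,
      Finset.sum_add_distrib, e, eq_comm (a := w)]
    fin_cases i
    · simpa using (hp0 w).symm
    · simpa using (hp1 w).symm
  rw [hsum]
  refine H.sum_mem fun v _ => ?_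
  have hpv : p v = 0 ∨ p v = 1 := by
    generalize p v = a
    revert a
    decide
  rcases hpv with h | h
  · simp [h, H.zero_mem]
  · rw [h]
    exact hH v

end Chains

/-! ### The code space and its logical operators -/

section Code

variable {L : ℕ} [NeZero L]

lemma plaquetteOp_eq (v : Site L) : plaquetteOp v = xOp (plaqVec v) := by
  simp only [plaquetteOp, pauliX_eq, xOp_mul, plaqVec]

lemma starOp_eq (v : Site L) : starOp v = zOp (starVec v) := by
  simp only [starOp, pauliZ_eq, zOp_mul, starVec]

lemma mem_codeSpace {ψ : StateVec (Link L)} :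
    ψ ∈ codeSpace L ↔ ∀ v, xOp (plaqVec v) *ᵥ ψ = ψ ∧ zOp (starVec v) *ᵥ ψ = ψ := by
  simp only [← plaquetteOp_eq, ← starOp_eq]
  rfl

/-- The configurations whose product of `X` stabilizes `ψ`. -/
def xStab {Q : Type} [Fintype Q] [DecidableEq Q] (ψ : StateVec Q) : AddSubgroup (Config Q) where
  carrier := {c | xOp c *ᵥ ψ = ψ}
  zero_mem' := by simp
  add_mem' := by
    intro a b ha hb
    change xOp (a + b) *ᵥ ψ = ψ
    rw [← xOp_mul, ← Matrix.mulVec_mulVec, hb, ha]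
  neg_mem' := by
    intro a ha
    rwa [neg_eq_of_add_eq_zero_left (config_add_self a)]

/-- The configurations whose product of `Z` stabilizes `ψ`. -/
def zStab {Q : Type} [Fintype Q] [DecidableEq Q] (ψ : StateVec Q) : AddSubgroup (Config Q) where
  carrier := {c | zOp c *ᵥ ψ = ψ}
  zero_mem' := by simp
  add_mem' := by
    intro a b ha hb
    change zOp (a + b) *ᵥ ψ = ψ
    rw [← zOp_mul, ← Matrix.mulVec_mulVec, hb, ha]
  neg_mem' := by
    intro a ha
    rwa [neg_eq_of_add_eq_zero_left (config_add_self a)]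

lemma xOp_mulVec_eq_of_add_mem {Q : Type} [Fintype Q] [DecidableEq Q] {ψ : StateVec Q}
    {c d : Config Q} (h : c + d ∈ xStab ψ) : xOp c *ᵥ ψ = xOp d *ᵥ ψ := by
  have h' : xOp (c + d) *ᵥ ψ = ψ := h
  conv_rhs => rw [← h']
  rw [Matrix.mulVec_mulVec, xOp_mul, add_comm d, config_add_cancel]

lemma zOp_mulVec_eq_of_add_mem {Q : Type} [Fintype Q] [DecidableEq Q] {ψ : StateVec Q}
    {c d : Config Q} (h : c + d ∈ zStab ψ) : zOp c *ᵥ ψ = zOp d *ᵥ ψ := by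
  have h' : zOp (c + d) *ᵥ ψ = ψ := h
  conv_rhs => rw [← h']
  rw [Matrix.mulVec_mulVec, zOp_mul, add_comm d, config_add_cancel]

/-- Lines that are consecutively equivalent modulo `H` are all equivalent. -/
lemma add_mem_of_consecutive (H : AddSubgroup (Config (Link L))) (f : ZMod L → Config (Link L))
    (h : ∀ y, f y + f (y + 1) ∈ H) (y : ZMod L) : f 0 + f y ∈ H := by
  have key : ∀ k : ℕ, f 0 + f (k : ZMod L) ∈ H := by
    intro k
    induction k with
    | zero => simp [config_add_self]
    | succ k ih =>
      have h1 := H.add_mem ih (h k)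
      rw [← add_assoc, config_add_cancel] at h1
      simpa using h1
  rw [← ZMod.natCast_zmod_val y]
  exact key _

lemma xOp_rowLine_mulVec {φ : StateVec (Link L)} (hφ : φ ∈ codeSpace L) (y : ZMod L) :
    xOp (rowLine 0 0) *ᵥ φ = xOp (rowLine 0 y) *ᵥ φ :=
  xOp_mulVec_eq_of_add_mem <| add_mem_of_consecutive (xStab φ) _ (fun y => by
    rw [← sum_plaqVec_row]
    exact (xStab φ).sum_mem fun x _ => (mem_codeSpace.1 hφ _).1) y

lemma xOp_colLine_mulVec {φ : StateVec (Link L)} (hφ : φ ∈ codeSpace L) (x : ZMod L) :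
    xOp (colLine 1 0) *ᵥ φ = xOp (colLine 1 x) *ᵥ φ :=
  xOp_mulVec_eq_of_add_mem <| add_mem_of_consecutive (xStab φ) _ (fun y => by
    rw [← sum_plaqVec_col]
    exact (xStab φ).sum_mem fun x _ => (mem_codeSpace.1 hφ _).1) x

lemma zOp_rowLine_mulVec {φ : StateVec (Link L)} (hφ : φ ∈ codeSpace L) (y : ZMod L) :
    zOp (rowLine 1 0) *ᵥ φ = zOp (rowLine 1 y) *ᵥ φ :=
  zOp_mulVec_eq_of_add_mem <| add_mem_of_consecutive (zStab φ) _ (fun y => by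
    have h := sum_starVec_row (y + 1)
    rw [add_sub_cancel_right, add_comm (rowLine 1 (y + 1))] at h
    rw [← h]
    exact (zStab φ).sum_mem fun x _ => (mem_codeSpace.1 hφ _).2) y

lemma zOp_colLine_mulVec {φ : StateVec (Link L)} (hφ : φ ∈ codeSpace L) (x : ZMod L) :
    zOp (colLine 0 0) *ᵥ φ = zOp (colLine 0 x) *ᵥ φ :=
  zOp_mulVec_eq_of_add_mem <| add_mem_of_consecutive (zStab φ) _ (fun y => by
    have h := sum_starVec_col (y + 1)
    rw [add_sub_cancel_right, add_comm (colLine 0 (y + 1))] at h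
    rw [← h]
    exact (zStab φ).sum_mem fun x _ => (mem_codeSpace.1 hφ _).2) x

/-- Products of `X` commute with all plaquettes, so only the signs against the stars matter. -/
lemma xOp_mulVec_mem_codeSpace {φ : StateVec (Link L)} (hφ : φ ∈ codeSpace L)
    {c : Config (Link L)} (hc : ∀ v, zChar (starVec v) c = 1) :
    xOp c *ᵥ φ ∈ codeSpace L := by
  refine mem_codeSpace.2 fun v => ⟨?_, ?_⟩
  · rw [Matrix.mulVec_mulVec, xOp_mul, add_comm, ← xOp_mul, ← Matrix.mulVec_mulVec,
      (mem_codeSpace.1 hφ v).1]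
  · rw [zOp_mulVec_xOp_mulVec, (mem_codeSpace.1 hφ v).2, hc, one_smul]

lemma zOp_mulVec_mem_codeSpace {φ : StateVec (Link L)} (hφ : φ ∈ codeSpace L)
    {c : Config (Link L)} (hc : ∀ v, zChar (plaqVec v) c = 1) :
    zOp c *ᵥ φ ∈ codeSpace L := by
  refine mem_codeSpace.2 fun v => ⟨?_, ?_⟩
  · have h := zOp_mulVec_xOp_mulVec (plaqVec v) c φ
    rw [zChar_comm, hc, one_smul, (mem_codeSpace.1 hφ v).1] at h
    exact h.symm
  · rw [Matrix.mulVec_mulVec, zOp_mul, add_comm, ← zOp_mul, ← Matrix.mulVec_mulVec,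
      (mem_codeSpace.1 hφ v).2]

lemma zChar_starVec_rowLine (v : Site L) : zChar (starVec v) (rowLine 0 0) = 1 := by
  rw [zChar_starVec, bichar_one_eq_one]
  simp [rowLine_apply, fin_two_add_self]

lemma zChar_starVec_colLine (v : Site L) : zChar (starVec v) (colLine 1 0) = 1 := by
  rw [zChar_starVec, bichar_one_eq_one]
  simp [colLine_apply, fin_two_add_self]

lemma zChar_plaqVec_rowLine (v : Site L) : zChar (plaqVec v) (rowLine 1 0) = 1 := by
  rw [zChar_plaqVec, bichar_one_eq_one]
  simp [rowLine_apply, fin_two_add_self]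

lemma zChar_plaqVec_colLine (v : Site L) : zChar (plaqVec v) (colLine 0 0) = 1 := by
  rw [zChar_plaqVec, bichar_one_eq_one]
  simp [colLine_apply, fin_two_add_self]

/-- The two loops share exactly one link. -/
lemma zChar_colLine_rowLine : zChar (colLine (L := L) 0 0) (rowLine 0 0) = -1 := by
  rw [zChar_colLine]
  simp [rowLine_apply, bichar]

lemma zChar_rowLine_colLine : zChar (rowLine (L := L) 1 0) (colLine 1 0) = -1 := by
  rw [zChar_rowLine]
  simp [colLine_apply, bichar]

lemma zChar_rowLine_rowLine : zChar (rowLine (L := L) 1 0) (rowLine 0 0) = 1 := by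
  rw [zChar_rowLine]
  simp [rowLine_apply]

/-- A state of the code space on which both `Z` loops are trivial is determined by its amplitude
at the zero configuration. -/
lemma codeSpace_eq_zero {ψ : StateVec (Link L)} (hψ : ψ ∈ codeSpace L)
    (hr : zOp (rowLine 1 0) *ᵥ ψ = ψ) (hc : zOp (colLine 0 0) *ᵥ ψ = ψ) (h0 : ψ 0 = 0) :
    ψ = 0 := by
  funext s
  by_contra hs
  have key : ∀ c : Config (Link L), zOp c *ᵥ ψ = ψ → zChar c s = 1 := fun c h => by
    have h1 := congrFun h s
    rw [zOp_mulVec] at h1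
    exact mul_right_cancel₀ hs (by rw [h1, one_mul])
  -- Each `Z` stabilizer has character `1` at any `s` in the support of `ψ`. So `s` is a cycle
  -- without winding, hence a sum of plaquettes, and `xOp s` relates `ψ s` to `ψ 0`.
  have hmem : s ∈ xStab ψ := by
    refine mem_of_closed _ (fun v => (mem_codeSpace.1 hψ v).1) s (fun v => ?_) ?_ ?_
    · rw [← bichar_one_eq_one, ← zChar_starVec]
      exact key _ (mem_codeSpace.1 hψ v).2
    · rw [← bichar_one_eq_one, ← zChar_rowLine]
      exact key _ hr
    · rw [← bichar_one_eq_one, ← zChar_colLine]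
      exact key _ hc
  have h2 : (xOp s *ᵥ ψ) s = ψ s := congrFun hmem s
  rw [xOp_mulVec, config_add_self, h0] at h2
  exact hs h2.symm

/-- An operator that commutes with an anticommuting pair of Pauli operators vanishes if it vanishes
on the `+1` eigenspace of one of them. -/
lemma vanishes_of_anticommute {Q : Type} [Fintype Q] [DecidableEq Q] (V : Submodule ℂ (StateVec Q))
    {c d : Config Q} (hcd : zChar d c = -1) (hX : ∀ ψ ∈ V, xOp c *ᵥ ψ ∈ V)
    (hZ : ∀ ψ ∈ V, zOp d *ᵥ ψ ∈ V) (N : Op Q)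
    (hNX : ∀ ψ ∈ V, N *ᵥ (xOp c *ᵥ ψ) = xOp c *ᵥ (N *ᵥ ψ))
    (hN : ∀ ψ ∈ V, zOp d *ᵥ ψ = ψ → N *ᵥ ψ = 0) (ψ : StateVec Q) (hψ : ψ ∈ V) : N *ᵥ ψ = 0 := by
  have zz : ∀ φ : StateVec Q, zOp d *ᵥ (zOp d *ᵥ φ) = φ := fun φ => by
    rw [Matrix.mulVec_mulVec, zOp_sq, Matrix.one_mulVec]
  have xx : ∀ φ : StateVec Q, xOp c *ᵥ (xOp c *ᵥ φ) = φ := fun φ => by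
    rw [Matrix.mulVec_mulVec, xOp_sq, Matrix.one_mulVec]
  have h1 : N *ᵥ (ψ + zOp d *ᵥ ψ) = 0 := by
    refine hN _ (V.add_mem hψ (hZ ψ hψ)) ?_
    rw [Matrix.mulVec_add, zz, add_comm]
  have hm : ψ - zOp d *ᵥ ψ ∈ V := V.sub_mem hψ (hZ ψ hψ)
  -- `X` carries the `-1` eigenvector into the `+1` eigenspace, where `N` vanishes.
  have h2 : N *ᵥ (xOp c *ᵥ (ψ - zOp d *ᵥ ψ)) = 0 := by
    refine hN _ (hX _ hm) ?_
    rw [zOp_mulVec_xOp_mulVec, hcd, Matrix.mulVec_sub, zz, neg_one_smul, ← Matrix.mulVec_neg,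
      neg_sub]
  rw [hNX _ hm] at h2
  have h3 : N *ᵥ (ψ - zOp d *ᵥ ψ) = 0 := by
    rw [← xx (N *ᵥ _), h2, Matrix.mulVec_zero]
  have h4 : (2 : ℂ) • ψ = (ψ + zOp d *ᵥ ψ) + (ψ - zOp d *ᵥ ψ) := by
    rw [two_smul]; abel
  have h5 : (2 : ℂ) • (N *ᵥ ψ) = 0 := by
    rw [← Matrix.mulVec_smul, h4, Matrix.mulVec_add, h1, h3, add_zero]
  exact (smul_eq_zero.1 h5).resolve_left two_ne_zero

/-- The logical Pauli operators of the toric code. -/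
def logicals (L : ℕ) [NeZero L] : Set (Op (Link L)) :=
  {xOp (rowLine 0 0), xOp (colLine 1 0), zOp (rowLine 1 0), zOp (colLine 0 0)}

/-- The logical Pauli operators act irreducibly on the code space. -/
lemma logicals_irreducible (M : Op (Link L)) (hMV : ∀ ψ ∈ codeSpace L, M *ᵥ ψ ∈ codeSpace L)
    (hM : ∀ O ∈ logicals L, ∀ ψ ∈ codeSpace L, M *ᵥ (O *ᵥ ψ) = O *ᵥ (M *ᵥ ψ)) :
    ∃ c : ℂ, ∀ ψ ∈ codeSpace L, M *ᵥ ψ = c • ψ := by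
  have hXr := hM (xOp (rowLine 0 0)) (by simp [logicals])
  have hXc := hM (xOp (colLine 1 0)) (by simp [logicals])
  have hZr := hM (zOp (rowLine 1 0)) (by simp [logicals])
  have hZc := hM (zOp (colLine 0 0)) (by simp [logicals])
  let V₀ : Submodule ℂ (StateVec (Link L)) :=
    codeSpace L ⊓ LinearMap.eqLocus (Matrix.mulVecLin (zOp (rowLine 1 0))) LinearMap.id
  have hV₀ : ∀ ψ, ψ ∈ V₀ ↔ ψ ∈ codeSpace L ∧ zOp (rowLine 1 0) *ᵥ ψ = ψ := fun ψ => Iff.rfl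
  obtain ⟨c, hc⟩ : ∃ c : ℂ, ∀ ψ ∈ V₀, zOp (colLine 0 0) *ᵥ ψ = ψ → M *ᵥ ψ = c • ψ := by
    -- The joint `+1` eigenspace of the `Z` loops is at most a line, on which `M` is a scalar. The
    -- second case makes a proof that it is nonzero unnecessary.
    by_cases h : ∃ ψ ∈ V₀, zOp (colLine 0 0) *ᵥ ψ = ψ ∧ ψ 0 ≠ 0
    · obtain ⟨ω, hω, hωc, hω0⟩ := h
      have hprop : ∀ ψ ∈ V₀, zOp (colLine 0 0) *ᵥ ψ = ψ → ψ = (ψ 0 / ω 0) • ω := by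
        intro ψ hψ hψc
        have hd := V₀.sub_mem hψ (V₀.smul_mem (ψ 0 / ω 0) hω)
        refine sub_eq_zero.1 (codeSpace_eq_zero hd.1 hd.2 ?_ ?_)
        · rw [Matrix.mulVec_sub, Matrix.mulVec_smul, hψc, hωc]
        · simp [hω0]
      refine ⟨(M *ᵥ ω) 0 / ω 0, fun ψ hψ hψc => ?_⟩
      have hMω := hprop (M *ᵥ ω) ⟨hMV ω hω.1, by
        change zOp (rowLine 1 0) *ᵥ (M *ᵥ ω) = M *ᵥ ω
        rw [← hZr ω hω.1, ((hV₀ ω).1 hω).2]⟩ (by rw [← hZc ω hω.1, hωc])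
      rw [hprop ψ hψ hψc, Matrix.mulVec_smul, hMω, smul_comm]
      simp [hω0]
    · push Not at h
      refine ⟨0, fun ψ hψ hψc => ?_⟩
      rw [codeSpace_eq_zero hψ.1 hψ.2 hψc (h ψ hψ hψc), Matrix.mulVec_zero, smul_zero]
  refine ⟨c, fun ψ hψ => ?_⟩
  have hN : ∀ φ, (M - c • 1) *ᵥ φ = M *ᵥ φ - c • φ := fun φ => by
    rw [Matrix.sub_mulVec, Matrix.smul_mulVec, Matrix.one_mulVec]
  -- The two anticommuting pairs are used in turn: this one removes the condition on the column
  -- loop, the next the one on the row loop.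
  have h1 : ∀ φ ∈ V₀, (M - c • 1) *ᵥ φ = 0 := by
    refine vanishes_of_anticommute V₀ zChar_colLine_rowLine (fun φ hφ => ?_) (fun φ hφ => ?_) _
      (fun φ hφ => ?_) (fun φ hφ h => ?_)
    · refine (hV₀ _).2 ⟨xOp_mulVec_mem_codeSpace hφ.1 zChar_starVec_rowLine, ?_⟩
      rw [zOp_mulVec_xOp_mulVec, zChar_rowLine_rowLine, one_smul, ((hV₀ φ).1 hφ).2]
    · refine (hV₀ _).2 ⟨zOp_mulVec_mem_codeSpace hφ.1 zChar_plaqVec_colLine, ?_⟩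
      rw [Matrix.mulVec_mulVec, zOp_mul, add_comm, ← zOp_mul, ← Matrix.mulVec_mulVec,
        ((hV₀ φ).1 hφ).2]
    · rw [hN, hN, hXr φ hφ.1, Matrix.mulVec_sub, Matrix.mulVec_smul]
    · rw [hN, hc φ hφ h, sub_self]
  have h2 := vanishes_of_anticommute (codeSpace L) zChar_rowLine_colLine
    (fun φ hφ => xOp_mulVec_mem_codeSpace hφ zChar_starVec_colLine)
    (fun φ hφ => zOp_mulVec_mem_codeSpace hφ zChar_plaqVec_rowLine) (M - c • 1)
    (fun φ hφ => by rw [hN, hN, hXc φ hφ, Matrix.mulVec_sub, Matrix.mulVec_smul])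
    (fun φ hφ h => h1 φ ((hV₀ φ).2 ⟨hφ, h⟩)) ψ hψ
  rwa [hN, sub_eq_zero] at h2

end Code


/-! ### The partial trace in Kraus form -/

section Keep

variable {P Q : Type} [Fintype P] [DecidableEq P] [Fintype Q] [DecidableEq Q] (keep : P ↪ Q)

/-- The configuration of all qubits that is `c` on the kept ones and `0` elsewhere. -/
def liftVec (c : Config P) : Config Q := fun q => ∑ p, if keep p = q then c p else 0

@[simp] lemma liftVec_keep (c : Config P) (p : P) : liftVec keep c (keep p) = c p := by
  simp [liftVec, keep.injective.eq_iff]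

lemma liftVec_of_notMem (c : Config P) {q : Q} (hq : q ∉ Set.range keep) :
    liftVec keep c q = 0 :=
  Finset.sum_eq_zero fun p _ => if_neg fun h => hq ⟨p, h⟩

lemma liftVec_add (c d : Config P) : liftVec keep (c + d) = liftVec keep c + liftVec keep d := by
  funext q
  by_cases hq : q ∈ Set.range keep
  · obtain ⟨p, rfl⟩ := hq
    simp
  · simp [liftVec_of_notMem keep _ hq]

lemma zChar_liftVec (c : Config P) (s : Config Q) :
    zChar (liftVec keep c) s = zChar c fun p => s (keep p) := by
  symm
  refine Fintype.prod_of_injective keep keep.injective _ _ (fun q hq => ?_) (fun p => ?_)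
  · rw [liftVec_of_notMem keep c hq, bichar_zero_left]
  · rw [liftVec_keep]

/-- The configurations of the qubits that are traced out. -/
abbrev EnvConfig : Type := {e : Config Q // ∀ p, e (keep p) = 0}

lemma exists_eq_liftVec_add (s : Config Q) :
    ∃ e : EnvConfig keep, s = liftVec keep (fun p => s (keep p)) + e.1 := by
  refine ⟨⟨s + liftVec keep fun p => s (keep p), fun p => ?_⟩, ?_⟩
  · simp [fin_two_add_self]
  · change s = liftVec keep (fun p => s (keep p)) + (s + liftVec keep fun p => s (keep p))
    rw [add_comm s, ← add_assoc, config_add_self, zero_add]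

lemma liftVec_add_env_inj {x y : Config P} {e f : EnvConfig keep} :
    liftVec keep x + e.1 = liftVec keep y + f.1 ↔ x = y ∧ e = f := by
  refine ⟨fun h => ?_, fun h => by rw [h.1, h.2]⟩
  have hxy : x = y := by
    funext p
    have := congrFun h (keep p)
    simpa [e.2 p, f.2 p] using this
  subst hxy
  exact ⟨rfl, Subtype.ext (add_left_cancel h)⟩

/-- The operator `1 ⊗ ⟨e|`, where `e` is a basis state of the qubits that are traced out. -/
def sliceOp (e : EnvConfig keep) : Matrix (Config P) (Config Q) ℂ :=
  Matrix.of fun x s => if s = liftVec keep x + e.1 then 1 else 0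

lemma sliceOp_mulVec (e : EnvConfig keep) (χ : StateVec Q) (x : Config P) :
    (sliceOp keep e *ᵥ χ) x = χ (liftVec keep x + e.1) := by
  simp [sliceOp, Matrix.mulVec, dotProduct]

lemma eq_of_sliceOp_mulVec_eq {χ χ' : StateVec Q}
    (h : ∀ e, sliceOp keep e *ᵥ χ = sliceOp keep e *ᵥ χ') : χ = χ' := by
  funext s
  obtain ⟨e, he⟩ := exists_eq_liftVec_add keep s
  have h1 := congrFun (h e) fun p => s (keep p)
  rwa [sliceOp_mulVec, sliceOp_mulVec, ← he] at h1

lemma sliceOp_mulVec_xOp (e : EnvConfig keep) (c : Config P) (χ : StateVec Q) :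
    sliceOp keep e *ᵥ (xOp (liftVec keep c) *ᵥ χ) = xOp c *ᵥ (sliceOp keep e *ᵥ χ) := by
  funext x
  rw [sliceOp_mulVec, xOp_mulVec, xOp_mulVec, sliceOp_mulVec, liftVec_add, add_right_comm]

lemma sliceOp_mulVec_zOp (e : EnvConfig keep) (c : Config P) (χ : StateVec Q) :
    sliceOp keep e *ᵥ (zOp (liftVec keep c) *ᵥ χ) = zOp c *ᵥ (sliceOp keep e *ᵥ χ) := by
  funext x
  rw [sliceOp_mulVec, zOp_mulVec, zOp_mulVec, sliceOp_mulVec, zChar_liftVec]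
  congr 2
  funext p
  simp [e.2 p]

open Classical in
-- The definition has no `DecidableEq Q`, so its sums use classical instances; `congr!` identifies
-- them with those of this section.
lemma traceOut_apply (M : Op Q) (x y : Config P) :
    traceOut keep M x y = ∑ s : Config Q, ∑ t : Config Q,
      if (∀ p, s (keep p) = x p) ∧ (∀ p, t (keep p) = y p) ∧
          (∀ q, q ∉ Set.range keep → s q = t q) then M s t
      else 0 := by
  simp only [traceOut, Matrix.of_apply]
  congr!

/-- The index pairs that contribute agree off the kept qubits, so they correspond to basis states
`e` of the environment. -/
lemma traceOut_eq (M : Op Q) :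
    traceOut keep M = ∑ e, sliceOp keep e * M * (sliceOp keep e)ᴴ := by
  ext x y
  have h1 : ∀ e, (sliceOp keep e * M * (sliceOp keep e)ᴴ) x y =
      M (liftVec keep x + e.1) (liftVec keep y + e.1) := by
    intro e
    simp [sliceOp, Matrix.mul_apply, apply_ite]
  simp only [Matrix.sum_apply, h1]
  rw [traceOut_apply]
  rw [← Fintype.sum_prod_type']
  symm
  refine Fintype.sum_of_injective
    (fun e : EnvConfig keep => (liftVec keep x + e.1, liftVec keep y + e.1)) ?_ _ _ ?_ ?_
  · intro e f h
    exact ((liftVec_add_env_inj keep).1 (Prod.mk.inj h).1).2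
  · rintro ⟨s, t⟩ hst
    refine if_neg fun ⟨hs, ht, hq⟩ => hst ?_
    obtain ⟨e, he⟩ := exists_eq_liftVec_add keep s
    have hx : (fun p => s (keep p)) = x := funext hs
    rw [hx] at he
    refine ⟨e, Prod.ext he.symm ?_⟩
    funext q
    by_cases h : q ∈ Set.range keep
    · obtain ⟨p, rfl⟩ := h
      simpa [e.2 p] using (ht p).symm
    · have h2 := congrFun he q
      simp only [Pi.add_apply, liftVec_of_notMem keep _ h, zero_add] at h2 ⊢
      rw [← h2]
      exact hq q h
  · intro e
    refine (if_pos ⟨fun p => ?_, fun p => ?_, fun q hq => ?_⟩).symm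
    · simp [e.2 p]
    · simp [e.2 p]
    · simp [liftVec_of_notMem keep _ hq]

lemma sum_sliceOp : ∑ e, (sliceOp keep e)ᴴ * sliceOp keep e = 1 := by
  refine op_ext fun χ => funext fun s => ?_
  obtain ⟨e, he⟩ := exists_eq_liftVec_add keep s
  have h1 : ∀ f : EnvConfig keep, (((sliceOp keep f)ᴴ * sliceOp keep f) *ᵥ χ) s =
      ∑ x, if s = liftVec keep x + f.1 then χ (liftVec keep x + f.1) else 0 := by
    intro f
    rw [← Matrix.mulVec_mulVec]
    simp only [Matrix.mulVec, dotProduct, Matrix.conjTranspose_apply]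
    refine Finset.sum_congr rfl fun x _ => ?_
    have := sliceOp_mulVec keep f χ x
    simp only [Matrix.mulVec, dotProduct] at this
    rw [this]
    simp only [sliceOp, Matrix.of_apply]
    split_ifs <;> simp
  rw [Matrix.sum_mulVec, Finset.sum_apply, Matrix.one_mulVec]
  simp only [h1]
  set x₀ : Config P := fun p => s (keep p)
  have h2 : ∀ (f : EnvConfig keep) (x : Config P), s = liftVec keep x + f.1 ↔ x₀ = x ∧ e = f := by
    intro f x
    conv_lhs => rw [he]
    exact liftVec_add_env_inj keep
  rw [Finset.sum_eq_single e, Finset.sum_eq_single x₀]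
  · rw [if_pos he, ← he]
  · intro x _ hx
    exact if_neg fun h => hx ((h2 e x).1 h).1.symm
  · simp
  · intro f _ hf
    exact Finset.sum_eq_zero fun x _ => if_neg fun h => hf ((h2 f x).1 h).2.symm
  · simp

end Keep

/-! ### Adding qubits in the state `|0⟩` -/

section Ancilla

variable {P A : Type} [Fintype P] [DecidableEq P] [Fintype A] [DecidableEq A]

/-- The isometry `ψ ↦ ψ ⊗ |0⟩`. -/
def ancillaOp (P A : Type) [Fintype P] [DecidableEq P] [Fintype A] [DecidableEq A] :
    Matrix (Config (P ⊕ A)) (Config P) ℂ :=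
  Matrix.of fun s x => if (∀ a, s (Sum.inr a) = 0) ∧ (fun p => s (Sum.inl p)) = x then 1 else 0

lemma ancillaOp_mulVec (ψ : StateVec P) (s : Config (P ⊕ A)) :
    (ancillaOp P A *ᵥ ψ) s =
      if ∀ a, s (Sum.inr a) = 0 then ψ fun p => s (Sum.inl p) else 0 := by
  simp [ancillaOp, Matrix.mulVec, dotProduct, ite_and]

lemma addAncillas_eq (ρ : Op P) :
    addAncillas (A := A) ρ = ancillaOp P A * ρ * (ancillaOp P A)ᴴ := by
  ext s t
  by_cases hs : ∀ a, s (Sum.inr a) = 0 <;> by_cases ht : ∀ a, t (Sum.inr a) = 0 <;>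
    simp [addAncillas, ancillaOp, Matrix.mul_apply, apply_ite, hs, ht]

lemma ancillaOp_isometry : (ancillaOp P A)ᴴ * ancillaOp P A = 1 := by
  refine op_ext fun ψ => funext fun x => ?_
  rw [← Matrix.mulVec_mulVec, Matrix.one_mulVec]
  simp only [Matrix.mulVec, dotProduct, Matrix.conjTranspose_apply]
  rw [Finset.sum_eq_single (Sum.elim x 0 : Config (P ⊕ A))]
  · have := ancillaOp_mulVec (A := A) ψ (Sum.elim x 0)
    simp only [Matrix.mulVec, dotProduct] at this
    rw [this]
    simp [ancillaOp]
  · intro s _ hs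
    rw [ancillaOp, Matrix.of_apply, if_neg, star_zero, zero_mul]
    rintro ⟨h1, h2⟩
    refine hs (funext fun q => ?_)
    rcases q with p | a
    · exact congrFun h2 p
    · exact h1 a
  · simp

lemma xOp_mulVec_ancillaOp (c : Config P) (ψ : StateVec P) :
    xOp (Sum.elim c 0 : Config (P ⊕ A)) *ᵥ (ancillaOp P A *ᵥ ψ) =
      ancillaOp P A *ᵥ (xOp c *ᵥ ψ) := by
  funext s
  simp only [xOp_mulVec, ancillaOp_mulVec, Pi.add_apply, Sum.elim_inr, Pi.zero_apply, add_zero,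
    Sum.elim_inl]
  rfl

lemma zChar_elim (c : Config P) (d : Config A) (s : Config (P ⊕ A)) :
    zChar (Sum.elim c d) s =
      zChar c (fun p => s (Sum.inl p)) * zChar d (fun a => s (Sum.inr a)) := by
  simp [zChar, Fintype.prod_sum_type]

lemma zOp_mulVec_ancillaOp (c : Config P) (d : Config A) (ψ : StateVec P) :
    zOp (Sum.elim c d : Config (P ⊕ A)) *ᵥ (ancillaOp P A *ᵥ ψ) =
      ancillaOp P A *ᵥ (zOp c *ᵥ ψ) := by
  funext s
  simp only [zOp_mulVec, ancillaOp_mulVec]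
  split_ifs with h
  · have : (fun a => s (Sum.inr a)) = 0 := funext h
    rw [zChar_elim, this, zChar_comm d, zChar_zero_left, mul_one]
  · rw [mul_zero]

/-- Being of the form `ψ ⊗ |0⟩` is a set of local stabilizer conditions, so it can be tested through
the light cone just like the code conditions. -/
lemma eq_ancillaOp_mulVec {χ : StateVec (P ⊕ A)}
    (h : ∀ a, zOp (Sum.elim 0 (Pi.single a 1) : Config (P ⊕ A)) *ᵥ χ = χ) :
    χ = ancillaOp P A *ᵥ fun x => χ (Sum.elim x 0) := by
  funext s
  rw [ancillaOp_mulVec]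
  split_ifs with hs
  · congr 1
    funext q
    rcases q with p | a
    · rfl
    · exact hs a
  · push Not at hs
    obtain ⟨a, ha⟩ := hs
    by_contra h0
    have h1 := congrFun (h a) s
    rw [zOp_mulVec, zChar_elim, zChar_zero_left, one_mul, zChar_single] at h1
    exact ha (bichar_one_eq_one.1 (mul_right_cancel₀ h0 (by rw [h1, one_mul])))

end Ancilla

/-! ### Distances on the torus -/

section Distance

variable {L : ℕ} [NeZero L]

lemma natAbs_valMinAbs_one_le : (1 : ZMod L).valMinAbs.natAbs ≤ 1 := by
  rw [ZMod.valMinAbs_natAbs_eq_min, ZMod.val_one_eq_one_mod]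
  exact (min_le_left _ _).trans (Nat.mod_le _ _)

lemma torusDist_le_one_of_plaqVec_ne {v : Site L} {l : Link L} (h : plaqVec v l ≠ 0) :
    torusDist l.1 v ≤ 1 := by
  have h1 := natAbs_valMinAbs_one_le (L := L)
  by_contra hd
  refine h ?_
  have key : ∀ (w : Site L) (i : Fin 2), torusDist w v ≤ 1 →
      (Pi.single (w, i) 1 : Config (Link L)) l = 0 := fun w i hw =>
    Pi.single_eq_of_ne (fun h => hd (by rw [h]; exact hw)) _
  simp only [plaqVec, Pi.add_apply]
  rw [key, key, key, key] <;> simp [torusDist, h1]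

lemma torusDist_le_one_of_starVec_ne {v : Site L} {l : Link L} (h : starVec v l ≠ 0) :
    torusDist l.1 v ≤ 1 := by
  have h1 := natAbs_valMinAbs_one_le (L := L)
  by_contra hd
  refine h ?_
  have key : ∀ (w : Site L) (i : Fin 2), torusDist w v ≤ 1 →
      (Pi.single (w, i) 1 : Config (Link L)) l = 0 := fun w i hw =>
    Pi.single_eq_of_ne (fun h => hd (by rw [h]; exact hw)) _
  simp only [starVec, Pi.add_apply]
  rw [key, key, key, key] <;> simp [torusDist, ZMod.natAbs_valMinAbs_neg, h1]

/-- No point of a long circle is close to both of two distant points. -/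
lemma far_or_far {k : ℕ} (hk : 2 * (2 * k + 1) ≤ L) (a : ZMod L) :
    k < (0 - a).valMinAbs.natAbs ∨ k < (((2 * k + 1 : ℕ) : ZMod L) - a).valMinAbs.natAbs := by
  by_contra! h
  have h1 := ZMod.natAbs_valMinAbs_add_le (((2 * k + 1 : ℕ) : ZMod L) - a) (-(0 - a))
  have h2 : ((2 * k + 1 : ℕ) : ZMod L) - a + -(0 - a) = ((2 * k + 1 : ℕ) : ZMod L) := by ring
  rw [h2, ZMod.valMinAbs_natCast_of_le_half (by omega)] at h1
  have h3 := ZMod.natAbs_valMinAbs_neg (0 - a)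
  have h4 := Int.natAbs_add_le (((2 * k + 1 : ℕ) : ZMod L) - a).valMinAbs (-(0 - a)).valMinAbs
  omega

end Distance

/-! ### Intertwining the logical operators, and the theorem -/

section Channel

variable {L : ℕ} [NeZero L] {r : ℕ} (C : LCTransformation L r)

/-- The Kraus operators of a local channel transformation. -/
def LCTransformation.kraus (e : EnvConfig C.keep) : Op (Link L) :=
  sliceOp C.keep e * circuitOp C.layers * ancillaOp (Link L) (Σ v : Site L, Fin (C.anc v))

lemma LCTransformation.channel_eq (ρ : Op (Link L)) :
    C.channel ρ = ∑ e, C.kraus e * ρ * (C.kraus e)ᴴ := by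
  rw [LCTransformation.channel, traceOut_eq, addAncillas_eq]
  refine Finset.sum_congr rfl fun e _ => ?_
  simp only [LCTransformation.kraus, Matrix.conjTranspose_mul, Matrix.mul_assoc]

lemma LCTransformation.circuit_isometry :
    (circuitOp C.layers)ᴴ * circuitOp C.layers = 1 :=
  mul_eq_one_comm.1 (circuitOp_mul_conjTranspose C.layers)

lemma LCTransformation.sum_kraus : ∑ e, (C.kraus e)ᴴ * C.kraus e = 1 := by
  set U := circuitOp C.layers with hU
  set J := ancillaOp (Link L) (Σ v : Site L, Fin (C.anc v)) with hJ
  calc ∑ e, (C.kraus e)ᴴ * C.kraus e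
      = Jᴴ * (Uᴴ * (∑ e, (sliceOp C.keep e)ᴴ * sliceOp C.keep e) * U) * J := by
        simp only [Matrix.mul_sum, Matrix.sum_mul]
        refine Finset.sum_congr rfl fun e _ => ?_
        simp only [LCTransformation.kraus, Matrix.conjTranspose_mul, Matrix.mul_assoc, ← hU, ← hJ]
    _ = 1 := by
        rw [sum_sliceOp, Matrix.mul_one, hU, C.circuit_isometry, Matrix.mul_one, hJ,
          ancillaOp_isometry]

lemma LCTransformation.kraus_mulVec_mem
    (hC : ∀ ψ ∈ codeSpace L, supp (C.channel (ketbra ψ)) ≤ codeSpace L)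
    (e : EnvConfig C.keep) (ψ : StateVec (Link L)) (hψ : ψ ∈ codeSpace L) :
    C.kraus e *ᵥ ψ ∈ codeSpace L := by
  have h : C.channel (ketbra ψ) = ∑ e, ketbra (C.kraus e *ᵥ ψ) := by
    simp only [C.channel_eq, ketbra_conj]
  have h1 := hC ψ hψ
  rw [h] at h1
  exact fun v => ⟨fixed_of_supp_sum _ _ (fun w hw => (h1 hw v).1) e,
    fixed_of_supp_sum _ _ (fun w hw => (h1 hw v).2) e⟩

lemma LCTransformation.suppOn_circuit_conj {v : Site L} {B : Op (Qubit L C.anc)}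
    (hB : SuppOn (qubitBall C.anc v 1) B) :
    SuppOn (qubitBall C.anc v (r + 1))
      (circuitOp C.layers * B * (circuitOp C.layers)ᴴ) := by
  intro S N hS
  refine SuppOn.circuitOp_conj C.layers 1 B C.disjoint C.gate_le hB S N fun q hq hT => hS q hq ?_
  have h1 : torusDist (siteOf q) v ≤ 1 + C.gateRange * C.layers.length := hT
  have h2 := C.range_le
  change torusDist (siteOf q) v ≤ r + 1
  omega

/-- If a logical operator can be supported in two distant places, a channel into the code
space intertwines it with an operator on the code space. -/
lemma LCTransformation.exists_intertwined
    (hV : ∀ e, ∀ ψ ∈ codeSpace L, C.kraus e *ᵥ ψ ∈ codeSpace L)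
    {O O' : Op (Link L)} (hO : ∀ φ ∈ codeSpace L, O *ᵥ φ = O' *ᵥ φ)
    {K K' : Op (Qubit L C.anc)}
    (hK : ∀ e χ, sliceOp C.keep e *ᵥ (K *ᵥ χ) = O *ᵥ (sliceOp C.keep e *ᵥ χ))
    (hK' : ∀ e χ, sliceOp C.keep e *ᵥ (K' *ᵥ χ) = O' *ᵥ (sliceOp C.keep e *ᵥ χ))
    (hfar : ∀ v, (∀ B, SuppOn (qubitBall C.anc v (r + 1)) B → Commute B K) ∨
      (∀ B, SuppOn (qubitBall C.anc v (r + 1)) B → Commute B K'))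
    (ψ : StateVec (Link L)) (hψ : ψ ∈ codeSpace L) :
    ∃ φ ∈ codeSpace L, ∀ e, O *ᵥ (C.kraus e *ᵥ ψ) = C.kraus e *ᵥ φ := by
  set U := circuitOp C.layers with hU
  set J := ancillaOp (Link L) (Σ v : Site L, Fin (C.anc v)) with hJ
  have hUU : Uᴴ * U = 1 := C.circuit_isometry
  have hUU' : U * Uᴴ = 1 := circuitOp_mul_conjTranspose C.layers
  have hkraus : ∀ e φ, C.kraus e *ᵥ φ = sliceOp C.keep e *ᵥ (U *ᵥ (J *ᵥ φ)) := fun e φ => by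
    simp only [Matrix.mulVec_mulVec, LCTransformation.kraus, ← hU, ← hJ, Matrix.mul_assoc]
  -- The hypothesis on the channel enters here: each slice lies in the code space, where the two
  -- loops act alike.
  have hKK' : K *ᵥ (U *ᵥ (J *ᵥ ψ)) = K' *ᵥ (U *ᵥ (J *ᵥ ψ)) :=
    eq_of_sliceOp_mulVec_eq C.keep fun e => by
      rw [hK, hK', ← hkraus, hO _ (hV e ψ hψ)]
  set χ := Uᴴ *ᵥ (K *ᵥ (U *ᵥ (J *ᵥ ψ))) with hχ
  have hfixK : ∀ (B K : Op (Qubit L C.anc)), Commute (U * B * Uᴴ) K →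
      B *ᵥ (J *ᵥ ψ) = J *ᵥ ψ →
      B *ᵥ (Uᴴ *ᵥ (K *ᵥ (U *ᵥ (J *ᵥ ψ)))) = Uᴴ *ᵥ (K *ᵥ (U *ᵥ (J *ᵥ ψ))) := by
    intro B K hBK hB
    have h1 : B * Uᴴ * K * U = Uᴴ * K * U * B := by
      calc B * Uᴴ * K * U = Uᴴ * U * B * Uᴴ * K * U := by rw [hUU, one_mul]
        _ = Uᴴ * (U * B * Uᴴ * K) * U := by simp only [mul_assoc]
        _ = Uᴴ * K * U * B * (Uᴴ * U) := by rw [hBK.eq]; simp only [mul_assoc]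
        _ = Uᴴ * K * U * B := by rw [hUU, mul_one]
    have h2 := congrArg (fun M => M *ᵥ (J *ᵥ ψ)) h1
    simp only [← Matrix.mulVec_mulVec] at h2
    rw [h2, hB]
  have hfix : ∀ (v : Site L) (B : Op (Qubit L C.anc)), SuppOn (qubitBall C.anc v 1) B →
      B *ᵥ (J *ᵥ ψ) = J *ᵥ ψ → B *ᵥ χ = χ := by
    intro v B hB hBJ
    have hBU := C.suppOn_circuit_conj hB
    -- The choice of loop may depend on `v`, because `χ` is the same vector for both.
    rcases hfar v with h | h
    · exact hfixK B K (h _ hBU) hBJ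
    · rw [hχ, hKK']
      exact hfixK B K' (h _ hBU) hBJ
  have hanc : χ = J *ᵥ fun x => χ (Sum.elim x 0) := by
    refine eq_ancillaOp_mulVec fun a => hfix a.1 _ (suppOn_zOp fun q hq => ?_) ?_
    · rcases q with l | b
      · rfl
      · refine Pi.single_eq_of_ne (fun h => hq ?_) _
        subst h
        change torusDist b.1 b.1 ≤ 1
        rw [torusDist_self]
        exact zero_le_one
    · rw [hJ, zOp_mulVec_ancillaOp, zOp_zero, Matrix.one_mulVec]
  refine ⟨fun x => χ (Sum.elim x 0), mem_codeSpace.2 fun v => ⟨?_, ?_⟩, fun e => ?_⟩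
  · have h1 : xOp (Sum.elim (plaqVec v) 0 : Config (Qubit L C.anc)) *ᵥ χ = χ := by
      refine hfix v _ (suppOn_xOp fun q hq => ?_) ?_
      · rcases q with l | b
        · by_contra h
          exact hq (torusDist_le_one_of_plaqVec_ne h)
        · rfl
      · rw [hJ, xOp_mulVec_ancillaOp, (mem_codeSpace.1 hψ v).1]
    funext x
    have h2 := congrFun h1 (Sum.elim x 0)
    rw [xOp_mulVec] at h2
    rw [xOp_mulVec, ← h2]
    congr 1
    funext q
    rcases q with l | b <;> simp
  · have h1 : zOp (Sum.elim (starVec v) 0 : Config (Qubit L C.anc)) *ᵥ χ = χ := by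
      refine hfix v _ (suppOn_zOp fun q hq => ?_) ?_
      · rcases q with l | b
        · by_contra h
          exact hq (torusDist_le_one_of_starVec_ne h)
        · rfl
      · rw [hJ, zOp_mulVec_ancillaOp, (mem_codeSpace.1 hψ v).2]
    funext x
    have h2 := congrFun h1 (Sum.elim x 0)
    rw [zOp_mulVec, zChar_elim, zChar_zero_left, mul_one] at h2
    rw [zOp_mulVec]
    exact h2
  · rw [hkraus e (fun x => χ (Sum.elim x 0)), ← hanc, hχ, hkraus, ← hK, Matrix.mulVec_mulVec _ U Uᴴ,
      hUU', Matrix.one_mulVec]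

/-- Kept qubits stay at their sites (`keep_site`), so distances survive the passage from output
links to circuit qubits. -/
lemma LCTransformation.liftVec_eq_zero {c : Config (Link L)} {v : Site L}
    (hc : ∀ l : Link L, torusDist l.1 v ≤ r + 1 → c l = 0) (q : Qubit L C.anc)
    (hq : q ∈ qubitBall C.anc v (r + 1)) : liftVec C.keep c q = 0 := by
  by_cases h : q ∈ Set.range C.keep
  · obtain ⟨l, rfl⟩ := h
    rw [liftVec_keep]
    refine hc l ?_
    rw [← C.keep_site l]
    exact hq
  · exact liftVec_of_notMem C.keep c h

lemma LCTransformation.exists_intertwined_xOp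
    (hV : ∀ e, ∀ ψ ∈ codeSpace L, C.kraus e *ᵥ ψ ∈ codeSpace L) {c c' : Config (Link L)}
    (hc : ∀ φ ∈ codeSpace L, xOp c *ᵥ φ = xOp c' *ᵥ φ)
    (hfar : ∀ v, (∀ l : Link L, torusDist l.1 v ≤ r + 1 → c l = 0) ∨
      (∀ l : Link L, torusDist l.1 v ≤ r + 1 → c' l = 0))
    (ψ : StateVec (Link L)) (hψ : ψ ∈ codeSpace L) :
    ∃ φ ∈ codeSpace L, ∀ e, xOp c *ᵥ (C.kraus e *ᵥ ψ) = C.kraus e *ᵥ φ :=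
  C.exists_intertwined hV hc (fun e => sliceOp_mulVec_xOp C.keep e c)
    (fun e => sliceOp_mulVec_xOp C.keep e c')
    (fun v => (hfar v).imp (fun h _ hB => hB.commute_xOp (C.liftVec_eq_zero h))
      (fun h _ hB => hB.commute_xOp (C.liftVec_eq_zero h))) ψ hψ

lemma LCTransformation.exists_intertwined_zOp
    (hV : ∀ e, ∀ ψ ∈ codeSpace L, C.kraus e *ᵥ ψ ∈ codeSpace L) {c c' : Config (Link L)}
    (hc : ∀ φ ∈ codeSpace L, zOp c *ᵥ φ = zOp c' *ᵥ φ)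
    (hfar : ∀ v, (∀ l : Link L, torusDist l.1 v ≤ r + 1 → c l = 0) ∨
      (∀ l : Link L, torusDist l.1 v ≤ r + 1 → c' l = 0))
    (ψ : StateVec (Link L)) (hψ : ψ ∈ codeSpace L) :
    ∃ φ ∈ codeSpace L, ∀ e, zOp c *ᵥ (C.kraus e *ᵥ ψ) = C.kraus e *ᵥ φ :=
  C.exists_intertwined hV hc (fun e => sliceOp_mulVec_zOp C.keep e c)
    (fun e => sliceOp_mulVec_zOp C.keep e c')
    (fun v => (hfar v).imp (fun h _ hB => hB.commute_zOp (C.liftVec_eq_zero h))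
      (fun h _ hB => hB.commute_zOp (C.liftVec_eq_zero h))) ψ hψ

lemma rowLine_far (d : Fin 2) {k : ℕ} (hk : 2 * (2 * k + 1) ≤ L) (v : Site L) :
    (∀ l : Link L, torusDist l.1 v ≤ k → rowLine d 0 l = 0) ∨
      (∀ l : Link L, torusDist l.1 v ≤ k → rowLine d ((2 * k + 1 : ℕ) : ZMod L) l = 0) := by
  refine (far_or_far hk v.2).imp (fun h l hl => ?_) (fun h l hl => ?_) <;>
  · rw [rowLine_apply, if_neg]
    rintro ⟨h1, -⟩
    rw [torusDist, h1] at hl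
    omega

lemma colLine_far (d : Fin 2) {k : ℕ} (hk : 2 * (2 * k + 1) ≤ L) (v : Site L) :
    (∀ l : Link L, torusDist l.1 v ≤ k → colLine d 0 l = 0) ∨
      (∀ l : Link L, torusDist l.1 v ≤ k → colLine d ((2 * k + 1 : ℕ) : ZMod L) l = 0) := by
  refine (far_or_far hk v.1).imp (fun h l hl => ?_) (fun h l hl => ?_) <;>
  · rw [colLine_apply, if_neg]
    rintro ⟨h1, -⟩
    rw [torusDist, h1] at hl
    omega

/-- A local channel transformation of the code space into itself whose range is small compared to
the size of the torus is unitary on the code space. -/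
lemma LCTransformation.actsAsUnitaryChannelOn_codeSpace (hr : 2 * (2 * (r + 1) + 1) ≤ L)
    (hC : ∀ ψ ∈ codeSpace L, supp (C.channel (ketbra ψ)) ≤ codeSpace L) :
    ActsAsUnitaryChannelOn (codeSpace L) C.channel := by
  have hV := C.kraus_mulVec_mem hC
  have hchan : C.channel = fun X => ∑ e, C.kraus e * X * (C.kraus e)ᴴ := funext C.channel_eq
  rw [hchan]
  refine actsAsUnitary_of_kraus (codeSpace L) C.kraus C.sum_kraus hV (logicals L) ?_ ?_
    logicals_irreducible
  · rintro O (rfl | rfl | rfl | rfl)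
    · exact xOp_conjTranspose _
    · exact xOp_conjTranspose _
    · exact zOp_conjTranspose _
    · exact zOp_conjTranspose _
  · rintro O (rfl | rfl | rfl | rfl)
    · exact C.exists_intertwined_xOp hV (fun φ hφ => xOp_rowLine_mulVec hφ _) (rowLine_far 0 hr)
    · exact C.exists_intertwined_xOp hV (fun φ hφ => xOp_colLine_mulVec hφ _) (colLine_far 1 hr)
    · exact C.exists_intertwined_zOp hV (fun φ hφ => zOp_rowLine_mulVec hφ _) (rowLine_far 1 hr)
    · exact C.exists_intertwined_zOp hV (fun φ hφ => zOp_colLine_mulVec hφ _) (colLine_far 0 hr)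

end Channel

end ToricLC

theorem theorem2 (r : ℕ → ℕ)
    (hr : Tendsto (fun L : ℕ => (r L : ℝ) / (L : ℝ)) atTop (𝓝 0)) :
    ∀ᶠ L : ℕ in atTop, ∀ [NeZero L], ∀ C : ToricLC.LCTransformation L (r L),
      (∀ ψ ∈ ToricLC.codeSpace L,
        ToricLC.supp (C.channel (ToricLC.ketbra ψ)) ≤ ToricLC.codeSpace L) →
      ToricLC.ActsAsUnitaryChannelOn (ToricLC.codeSpace L) C.channel := by
  -- The separation of loops needs `4 * r L + 6 ≤ L`: each summand is at most `L / 2` once `8 * r L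
  -- < L` and `12 ≤ L`.
  filter_upwards [hr.eventually (gt_mem_nhds (show (0 : ℝ) < 1 / 8 by norm_num)),
    eventually_ge_atTop 12] with L hL hL12
  intro _ C hC
  refine C.actsAsUnitaryChannelOn_codeSpace ?_ hC
  have hL0 : (0 : ℝ) < L := by exact_mod_cast (by omega : 0 < L)
  rw [div_lt_iff₀ hL0] at hL
  have h8 : 8 * r L < L := by
    have : (8 : ℝ) * r L < L := by linarith
    exact_mod_cast this
  omega
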